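/- Let $p>3$ be a prime. Then $$\sum_{k=0}^{(p-3)/2}\frac{\binom{2k}{k}^2H_k}{(2k+1)16^k}\equiv 4q_p(2)^2+2\left(\frac{-1}{p}\right)\left(E_{2p-4}-2E_{p-3}\right)+\frac{7}{12}\,p\,B_{p-3}\pmod{p^2}$$ and $$\sum_{k=0}^{(p-3)/2}\frac{\binom{2k}{k}^2H_{2k}}{(2k+1)16^k}\equiv-2\left(\frac{-1}{p}\right)E_{p-3}\pmod p.$$ Here $H_n=\sum_{0<j\le n}\frac1j$ are the harmonic numbers, $q_p(2)=(2^{p-1}-1)/p$ is the Fermat quotient, $\left(\frac{\cdot}{p}\right)$ is the Legendre symbol, the Bernoulli numbers $B_n$ are given by $B_0=1$ and $\sum_{k=0}^{n-1}\binom nk B_k=0$ for $n\ge2$, and the Euler numbers $E_n$ are given by $E_0=1$ and $E_n=-\sum_{k=1}^{\lfloor n/2\rfloor}\binom{n}{2k}E_{n-2k}$ for $n\ge1$. For rational numbers $a,b$ and $m\ge1$, the congruence $a\equiv b\pmod m$ means that $a$ and $b$ have denominators prime to $m$ and that $a-b=mt$ for some rational $t$ whose denominator is prime to $m$. -/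

import Mathlib

/-- The Euler numbers: `E 0 = 1` and `E n = -∑_{k=1}^{⌊n/2⌋} (n choose 2k) * E (n - 2k)` for `n ≥ 1`.
In the sum below the index `j` stands for `k - 1`. -/
def eulerNumber : ℕ → ℤ
  | 0 => 1
  | n + 1 => -∑ j : Fin ((n + 1) / 2),
      ((n + 1).choose (2 * (j.val + 1)) : ℤ) * eulerNumber (n + 1 - 2 * (j.val + 1))
decreasing_by omega

theorem eulerNumber_zero : eulerNumber 0 = 1 := by
  rw [eulerNumber]

/-- The defining recurrence of the Euler numbers, in its usual form. -/
theorem eulerNumber_eq (n : ℕ) (hn : 1 ≤ n) :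
    eulerNumber n =
      -∑ k ∈ Finset.Icc 1 (n / 2), (n.choose (2 * k) : ℤ) * eulerNumber (n - 2 * k) := by
  obtain ⟨m, rfl⟩ : ∃ m, n = m + 1 := ⟨n - 1, by omega⟩
  rw [eulerNumber, Fin.sum_univ_eq_sum_range
    (fun j => ((m + 1).choose (2 * (j + 1)) : ℤ) * eulerNumber (m + 1 - 2 * (j + 1))),
    Finset.range_eq_Ico, Finset.sum_Ico_add'
    (fun k => ((m + 1).choose (2 * k) : ℤ) * eulerNumber (m + 1 - 2 * k))]
  rfl

/-- The Fermat quotient `q_p(a) = (a ^ (p - 1) - 1) / p`, as a rational number. -/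
def fermatQuotient (p : ℕ) (a : ℤ) : ℚ :=
  ((a : ℚ) ^ (p - 1) - 1) / (p : ℚ)

/-- The congruence `a ≡ b (mod m)` between rational numbers: both `a` and `b` have denominator
prime to `m`, and so has the quotient `t` in `a - b = m * t`. -/
def RatCongr (m : ℕ) (a b : ℚ) : Prop :=
  a.den.Coprime m ∧ b.den.Coprime m ∧ ∃ t : ℚ, t.den.Coprime m ∧ a - b = (m : ℚ) * t

/-! Write `p = 2n + 1`, `q` for the Fermat quotient, `A_m` and `S_m` for the sums of `(-1)^j / j^m`
and `1 / j^m` over `0 < j ≤ n`. Modulo `p²` the weight `C(2k,k)² / 16^k` equals the shifted Legendre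
coefficient `(-1)^k C(n,k) C(n+k,k)` (`choose_sq_div_pow_pCongr`). With that weight, the sum over `0
≤ k ≤ n`, multiplied by `2n + 1`, has a closed form: `2 A_1` for `H_k` and `2 A_1 - H_n` for
`H_{2k}`.

The extra term `k = n` has denominator `2k + 1 = p`. Hence `p` times each required sum is the closed
form minus `(-1)^n C(2n,n)` times `H_n` or `H_{2n}`, and everything is needed to one more power of
`p`. The inputs are Morley's congruence `(-1)^n C(2n,n) ≡ (1 + pq)²` mod `p³`, `H_n ≡ -2q + pq²` mod
`p²`, `H_{p-1} ≡ 0` mod `p²`, and `2 A_1 - H_n ≡ -p A_2 + (7/12) p² B_{p-3}` mod `p³`.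

Finally, `A_2` is expressed by Euler numbers, through the values at odd integers of a polynomial
satisfying `P(x+1) + P(x-1) = 2 x^m`. -/

open Finset

/-! ### Closed forms for harmonic sums weighted by shifted Legendre coefficients. -/

/-- The coefficient of `x ^ k` in the shifted Legendre polynomial of degree `n`. -/
def shiftedLegendreCoeff (n k : ℕ) : ℚ := (-1) ^ k * n.choose k * (n + k).choose k

/-- Half the difference of `(2n + 1) / (2k + 1) * shiftedLegendreCoeff n k` in the degree `n`. -/
def legendreDiffCoeff (n k : ℕ) : ℚ := (-1) ^ k * (n + 1).choose k * (n + k).choose k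

theorem sum_alternating_choose_succ (m : ℕ) (g : ℕ → ℚ) :
    ∑ k ∈ range (m + 2), (-1) ^ k * ((m + 1).choose k : ℚ) * g k =
      ∑ k ∈ range (m + 1), (-1) ^ k * (m.choose k : ℚ) * (g k - g (k + 1)) := by
  rw [sum_range_succ']
  simp only [Nat.choose_succ_succ, Nat.cast_add, mul_sub, sum_sub_distrib, add_mul, mul_add,
    sum_add_distrib]
  have h : ∑ k ∈ range (m + 1), (-1) ^ k * (m.choose k : ℚ) * g k =
      ∑ k ∈ range (m + 1), (-1) ^ (k + 1) * (m.choose (k + 1) : ℚ) * g (k + 1) + g 0 := by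
    have := sum_range_succ' (fun k => (-1) ^ k * (m.choose k : ℚ) * g k) (m + 1)
    rw [sum_range_succ] at this
    simpa using this
  rw [h]
  simp only [pow_succ, Nat.choose_zero_right]
  simp only [mul_neg, mul_one, neg_mul, sum_neg_distrib, pow_zero, Nat.cast_one, one_mul]
  ring

/-- An `m`-th finite difference kills a polynomial in `k` of degree `j < m`; each difference lowers
the lower index of the binomial by one. -/
theorem sum_alternating_choose_of_lt (a : ℕ) {m j : ℕ} (h : j < m) :
    ∑ k ∈ range (m + 1), (-1) ^ k * (m.choose k : ℚ) * ((a + k).choose j : ℚ) = 0 := by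
  induction m generalizing j with
  | zero => omega
  | succ m ih =>
    rw [sum_alternating_choose_succ m (fun k => ((a + k).choose j : ℚ))]
    cases j with
    | zero => simp
    | succ j =>
      have := ih (j := j) (by omega)
      rw [← neg_eq_zero, ← sum_neg_distrib] at this
      rw [← this]
      refine sum_congr rfl fun k _ => ?_
      rw [← add_assoc, Nat.choose_succ_succ]
      push_cast
      ring

theorem sum_alternating_choose_self (a m : ℕ) :
    ∑ k ∈ range (m + 1), (-1) ^ k * (m.choose k : ℚ) * ((a + k).choose m : ℚ) = (-1) ^ m := by
  induction m with
  | zero => simp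
  | succ m ih =>
    rw [sum_alternating_choose_succ m (fun k => ((a + k).choose (m + 1) : ℚ)), pow_succ, ← ih,
      sum_mul]
    refine sum_congr rfl fun k _ => ?_
    rw [← add_assoc, Nat.choose_succ_succ]
    push_cast
    ring

/-- In this form the last factor is a polynomial in `k` of degree `n`, so sums over `k` are finite
differences of order `n + 1`. -/
theorem legendreDiffCoeff_eq (n k : ℕ) :
    legendreDiffCoeff n k = (-1) ^ k * (n + 1).choose k * (n + k).choose n := by
  rw [legendreDiffCoeff, ← Nat.choose_symm_add]

theorem sum_legendreDiffCoeff (n : ℕ) : ∑ k ∈ range (n + 2), legendreDiffCoeff n k = 0 := by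
  simp only [legendreDiffCoeff_eq]
  exact sum_alternating_choose_of_lt n (Nat.lt_succ_self n)

theorem sum_mul_legendreDiffCoeff (n : ℕ) :
    ∑ k ∈ range (n + 2), (k : ℚ) * legendreDiffCoeff n k = (n + 1) * (-1) ^ (n + 1) := by
  rw [← sum_alternating_choose_self n (n + 1), mul_sum]
  refine sum_congr rfl fun k _ => ?_
  have h : ((n + k).choose (n + 1) : ℚ) * (n + 1) = (n + k).choose n * k := by
    have := Nat.choose_succ_right_eq (n + k) n
    rw [Nat.add_sub_cancel_left] at this
    exact_mod_cast this
  rw [legendreDiffCoeff_eq]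
  linear_combination -((-1) ^ k * (n + 1).choose k : ℚ) * h

theorem legendreDiffCoeff_of_lt {n k : ℕ} (h : n + 1 < k) : legendreDiffCoeff n k = 0 := by
  simp [legendreDiffCoeff, Nat.choose_eq_zero_of_lt h]

theorem succ_mul_choose_succ_eq (m k : ℕ) :
    ((k : ℚ) + 1) * m.choose (k + 1) = (m - k) * m.choose k := by
  rcases lt_or_ge m k with h | h
  · rw [Nat.choose_eq_zero_of_lt h, Nat.choose_eq_zero_of_lt (by omega)]
    simp
  · have := Nat.choose_succ_right_eq m k
    rw [mul_comm, mul_comm _ (m.choose k : ℚ), ← Nat.cast_sub h]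
    exact_mod_cast this

theorem succ_mul_choose_add_succ (m k : ℕ) :
    ((k : ℚ) + 1) * (m + (k + 1)).choose (k + 1) = (m + k + 1) * (m + k).choose k := by
  have := Nat.add_one_mul_choose_eq (m + k) k
  rw [← add_assoc, mul_comm]
  exact_mod_cast this.symm

/-- Equivalently `(n+1)² d_k = k² d_k - (k+1)² d_{k+1}`, which is what makes summation by parts
work. -/
theorem legendreDiffCoeff_succ (n k : ℕ) :
    ((k : ℚ) + 1) ^ 2 * legendreDiffCoeff n (k + 1) =
      -((n + 1) ^ 2 - k ^ 2) * legendreDiffCoeff n k := by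
  have h1 := succ_mul_choose_succ_eq (n + 1) k
  have h2 := succ_mul_choose_add_succ n k
  push_cast at h1
  simp only [legendreDiffCoeff, pow_succ]
  linear_combination (-(-1) ^ k * ((k : ℚ) + 1) * (n + (k + 1)).choose (k + 1)) * h1
    - (-1) ^ k * ((n : ℚ) + 1 - k) * (n + 1).choose k * h2

theorem shiftedLegendreCoeff_succ (n k : ℕ) :
    ((k : ℚ) + 1) ^ 2 * shiftedLegendreCoeff n (k + 1) =
      -((n - k) * (n + k + 1)) * shiftedLegendreCoeff n k := by
  have h1 := succ_mul_choose_succ_eq n k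
  have h2 := succ_mul_choose_add_succ n k
  simp only [shiftedLegendreCoeff, pow_succ]
  linear_combination (-(-1) ^ k * ((k : ℚ) + 1) * (n + (k + 1)).choose (k + 1)) * h1
    - (-1) ^ k * ((n : ℚ) - k) * n.choose k * h2

theorem succ_mul_shiftedLegendreCoeff_succ (n k : ℕ) :
    ((n : ℚ) + 1) * shiftedLegendreCoeff (n + 1) k = (n + 1 + k) * legendreDiffCoeff n k := by
  have h : ((n : ℚ) + 1) * (n + 1 + k).choose k = (n + 1 + k) * (n + k).choose k := by
    have := Nat.add_one_mul_choose_eq (n + k) n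
    rw [Nat.choose_symm_add, show n + k + 1 = n + 1 + k by ring, Nat.choose_symm_add] at this
    rw [mul_comm]
    exact_mod_cast this.symm
  simp only [shiftedLegendreCoeff, legendreDiffCoeff]
  linear_combination ((-1) ^ k * (n + 1).choose k : ℚ) * h

theorem succ_mul_shiftedLegendreCoeff (n k : ℕ) :
    ((n : ℚ) + 1) * shiftedLegendreCoeff n k = (n + 1 - k) * legendreDiffCoeff n k := by
  have h : ((n : ℚ) + 1) * n.choose k = (n + 1 - k) * (n + 1).choose k := by
    have h1 := succ_mul_choose_succ_eq (n + 1) k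
    have h2 := Nat.add_one_mul_choose_eq n k
    have h3 : ((n : ℚ) + 1) * n.choose k = (n + 1).choose (k + 1) * (k + 1) := by exact_mod_cast h2
    push_cast at h1
    linear_combination h3 + h1
  simp only [shiftedLegendreCoeff, legendreDiffCoeff]
  linear_combination ((-1) ^ k * (n + k).choose k : ℚ) * h

/-- The denominator cancels because `(2n+3)(n+1+k) - (2n+1)(n+1-k) = 2(n+1)(2k+1)`. -/
theorem shiftedLegendreCoeff_sub (n k : ℕ) :
    (2 * (n + 1 : ℚ) + 1) * shiftedLegendreCoeff (n + 1) k / (2 * k + 1) -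
      (2 * (n : ℚ) + 1) * shiftedLegendreCoeff n k / (2 * k + 1) = 2 * legendreDiffCoeff n k := by
  have h1 := succ_mul_shiftedLegendreCoeff_succ n k
  have h2 := succ_mul_shiftedLegendreCoeff n k
  have h3 : (n : ℚ) + 1 ≠ 0 := by positivity
  have h4 : 2 * (k : ℚ) + 1 ≠ 0 := by positivity
  rw [← sub_div, div_eq_iff h4]
  apply mul_left_cancel₀ h3
  linear_combination (2 * (n + 1 : ℚ) + 1) * h1 - (2 * (n : ℚ) + 1) * h2

theorem shiftedLegendreCoeff_of_lt {n k : ℕ} (h : n < k) : shiftedLegendreCoeff n k = 0 := by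
  simp [shiftedLegendreCoeff, Nat.choose_eq_zero_of_lt h]

/-- Summation by parts against the coefficients `legendreDiffCoeff n k`. -/
theorem sum_legendreDiffCoeff_mul (n : ℕ) (f : ℕ → ℚ) :
    ((n : ℚ) + 1) ^ 2 * ∑ k ∈ range (n + 2), legendreDiffCoeff n k * f k =
      ∑ k ∈ range (n + 1), (k + 1) ^ 2 * legendreDiffCoeff n (k + 1) * (f (k + 1) - f k) := by
  -- For a partial sum a boundary term remains; at `m = n + 2` it vanishes.
  have key : ∀ m : ℕ, ((n : ℚ) + 1) ^ 2 * ∑ k ∈ range m, legendreDiffCoeff n k * f k =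
      ∑ k ∈ range m, ((k : ℚ) + 1) ^ 2 * legendreDiffCoeff n (k + 1) * (f (k + 1) - f k) -
        m ^ 2 * legendreDiffCoeff n m * f m := by
    intro m
    induction m with
    | zero => simp
    | succ m ih =>
      rw [sum_range_succ, sum_range_succ, mul_add, ih]
      have := legendreDiffCoeff_succ n m
      push_cast
      linear_combination (f m) * this
  rw [key, sum_range_succ, legendreDiffCoeff_of_lt (Nat.lt_succ_self (n + 1))]
  ring

theorem sum_legendreDiffCoeff_mul_harmonic (n : ℕ) :
    ∑ k ∈ range (n + 2), legendreDiffCoeff n k * harmonic k = (-1) ^ (n + 1) / (n + 1) := by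
  have h3 : (n : ℚ) + 1 ≠ 0 := by positivity
  have h := sum_legendreDiffCoeff_mul n harmonic
  have h' := sum_mul_legendreDiffCoeff n
  rw [sum_range_succ'] at h'
  rw [eq_div_iff h3]
  apply mul_left_cancel₀ h3
  rw [← h']
  push_cast
  rw [zero_mul, add_zero]
  trans ((n : ℚ) + 1) ^ 2 * ∑ k ∈ range (n + 2), legendreDiffCoeff n k * harmonic k
  · ring
  rw [h]
  refine sum_congr rfl fun k _ => ?_
  rw [harmonic_succ]
  push_cast
  field_simp
  ring

/-- Induction on `n`: `(n+1) d_{n+1,k} - (n+2) d_{n,k}` is `2k - 1` times a term whose alternating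
sum is an `(n+2)`-th difference of a polynomial of degree `n`, hence zero. -/
theorem sum_legendreDiffCoeff_div (n : ℕ) :
    ∑ k ∈ range (n + 2), legendreDiffCoeff n k / (2 * k - 1) = -2 * (n + 1) := by
  have hne : ∀ k : ℕ, (2 * (k : ℚ) - 1) ≠ 0 := by
    intro k h
    have : (2 * k : ℤ) = 1 := by exact_mod_cast sub_eq_zero.mp h
    omega
  induction n with
  | zero => norm_num [sum_range_succ, legendreDiffCoeff]
  | succ n ih =>
    have hz := sum_alternating_choose_of_lt n (show n < n + 2 by omega)
    have hs : ∀ k : ℕ, ((n : ℚ) + 1) * legendreDiffCoeff (n + 1) k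
        - (n + 2) * legendreDiffCoeff n k =
        (2 * k - 1) * ((-1) ^ k * (n + 2).choose k * (n + k).choose n) := by
      intro k
      have e1 : ((n : ℚ) + 1) * (n + 1 + k).choose k = (n + 1 + k) * (n + k).choose n := by
        have := Nat.add_one_mul_choose_eq (n + k) n
        rw [Nat.choose_symm_add, show n + k + 1 = n + 1 + k by ring, Nat.choose_symm_add] at this
        rw [mul_comm, Nat.choose_symm_add]
        exact_mod_cast this.symm
      have e2 : ((n : ℚ) + 2) * (n + 1).choose k = (n + 2 - k) * (n + 2).choose k := by
        have h1 := succ_mul_choose_succ_eq (n + 2) k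
        have h2 := Nat.add_one_mul_choose_eq (n + 1) k
        have h3 : ((n : ℚ) + 2) * (n + 1).choose k = (n + 2).choose (k + 1) * (k + 1) := by
          exact_mod_cast h2
        push_cast at h1
        linear_combination h3 + h1
      rw [legendreDiffCoeff_eq n, legendreDiffCoeff]
      linear_combination ((-1) ^ k * (n + 2).choose k : ℚ) * e1
        - ((-1) ^ k * (n + k).choose n : ℚ) * e2
    have h0 : ((n : ℚ) + 1) * ∑ k ∈ range (n + 3), legendreDiffCoeff (n + 1) k / (2 * k - 1)
        - (n + 2) * ∑ k ∈ range (n + 3), legendreDiffCoeff n k / (2 * k - 1) = 0 := by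
      rw [← hz, mul_sum, mul_sum, ← sum_sub_distrib]
      refine sum_congr rfl fun k _ => ?_
      have := hs k
      have := hne k
      field_simp
      linear_combination hs k
    rw [sum_range_succ (fun k : ℕ => legendreDiffCoeff n k / (2 * (k : ℚ) - 1)) (n + 2),
      legendreDiffCoeff_of_lt (Nat.lt_succ_self (n + 1)), ih] at h0
    have h3 : (n : ℚ) + 1 ≠ 0 := by positivity
    apply mul_left_cancel₀ h3
    push_cast
    linear_combination h0

theorem sum_legendreDiffCoeff_mul_harmonic_two_mul (n : ℕ) :
    ∑ k ∈ range (n + 2), legendreDiffCoeff n k * harmonic (2 * k) =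
      (-1) ^ (n + 1) / (n + 1) - 1 / (2 * (n + 1)) := by
  have hne : ∀ k : ℕ, (2 * (k : ℚ) - 1) ≠ 0 := by
    intro k h
    have : (2 * k : ℤ) = 1 := by exact_mod_cast sub_eq_zero.mp h
    omega
  have h3 : (n : ℚ) + 1 ≠ 0 := by positivity
  have h := sum_legendreDiffCoeff_mul n (fun k => harmonic (2 * k))
  have h1 := sum_mul_legendreDiffCoeff n
  have h2 := sum_legendreDiffCoeff n
  have h4 := sum_legendreDiffCoeff_div n
  -- After the shift `k + 1 → k`, this is `k² (1/(2k) + 1/(2k-1)) = k + 1/4 + 1/(4(2k-1))`; the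
  -- right side vanishes at `k = 0`, so that term may be added.
  have e : ∑ k ∈ range (n + 1), ((k : ℚ) + 1) ^ 2 * legendreDiffCoeff n (k + 1) *
      (harmonic (2 * (k + 1)) - harmonic (2 * k)) =
      ∑ k ∈ range (n + 2), ((k : ℚ) * legendreDiffCoeff n k + legendreDiffCoeff n k / 4 +
        legendreDiffCoeff n k / (2 * k - 1) / 4) := by
    rw [sum_range_succ' (fun k : ℕ => (k : ℚ) * legendreDiffCoeff n k + legendreDiffCoeff n k / 4 +
        legendreDiffCoeff n k / (2 * k - 1) / 4) (n + 1)]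
    have e0 : ((0 : ℕ) : ℚ) * legendreDiffCoeff n 0 + legendreDiffCoeff n 0 / 4 +
        legendreDiffCoeff n 0 / (2 * ((0 : ℕ) : ℚ) - 1) / 4 = 0 := by
      push_cast
      ring
    rw [e0, add_zero]
    refine sum_congr rfl fun k _ => ?_
    push_cast
    have e1 : (2 * ((k : ℚ) + 1) - 1) = 2 * k + 1 := by ring
    have e2 : (2 * (k : ℚ) + 1) ≠ 0 := by positivity
    rw [show 2 * (k + 1) = 2 * k + 1 + 1 by ring, harmonic_succ, harmonic_succ, e1]
    push_cast
    have e3 : (2 * (k : ℚ) + 1 + 1) ≠ 0 := by positivity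
    field_simp
    ring
  rw [sum_add_distrib, sum_add_distrib, ← sum_div, ← sum_div, h1, h2, h4] at e
  rw [e] at h
  apply mul_left_cancel₀ (pow_ne_zero 2 h3)
  rw [h]
  field_simp
  ring

theorem sum_shiftedLegendreCoeff_succ_sub (n : ℕ) (f : ℕ → ℚ) :
    (2 * (n + 1 : ℚ) + 1) * ∑ k ∈ range (n + 2), shiftedLegendreCoeff (n + 1) k * f k / (2 * k + 1)
      = (2 * (n : ℚ) + 1) * ∑ k ∈ range (n + 1), shiftedLegendreCoeff n k * f k / (2 * k + 1)
        + 2 * ∑ k ∈ range (n + 2), legendreDiffCoeff n k * f k := by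
  have h : ∑ k ∈ range (n + 1), shiftedLegendreCoeff n k * f k / (2 * k + 1) =
      ∑ k ∈ range (n + 2), shiftedLegendreCoeff n k * f k / (2 * k + 1) := by
    rw [sum_range_succ _ (n + 1), shiftedLegendreCoeff_of_lt (Nat.lt_succ_self n)]
    simp
  rw [h, mul_sum, mul_sum, mul_sum, ← sum_add_distrib]
  refine sum_congr rfl fun k _ => ?_
  linear_combination (f k) * shiftedLegendreCoeff_sub n k

/-- Telescoping in `n`: each increment is a sum free of the denominators `2k + 1`, evaluated by
parts. -/
theorem sum_shiftedLegendreCoeff_mul_harmonic (n : ℕ) :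
    (2 * (n : ℚ) + 1) *
      ∑ k ∈ range (n + 1), shiftedLegendreCoeff n k * harmonic k / (2 * k + 1) =
      2 * ∑ k ∈ range n, (-1) ^ (k + 1) / ((k : ℚ) + 1) := by
  induction n with
  | zero => simp
  | succ n ih =>
    have := sum_shiftedLegendreCoeff_succ_sub n harmonic
    rw [sum_range_succ _ n]
    push_cast
    rw [this, ih, sum_legendreDiffCoeff_mul_harmonic]
    ring

theorem sum_shiftedLegendreCoeff_mul_harmonic_two_mul (n : ℕ) :
    (2 * (n : ℚ) + 1) *
      ∑ k ∈ range (n + 1), shiftedLegendreCoeff n k * harmonic (2 * k) / (2 * k + 1) =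
      2 * ∑ k ∈ range n, (-1) ^ (k + 1) / ((k : ℚ) + 1) - harmonic n := by
  induction n with
  | zero => simp
  | succ n ih =>
    have := sum_shiftedLegendreCoeff_succ_sub n (fun k => harmonic (2 * k))
    rw [sum_range_succ _ n]
    push_cast
    rw [this, ih, sum_legendreDiffCoeff_mul_harmonic_two_mul, harmonic_succ]
    push_cast
    field_simp
    ring

/-! ### Congruences between `p`-integral rationals. -/

/-- The rational numbers whose denominator is prime to `p`. -/
def pIntegral (p : ℕ) : Subring ℚ where
  carrier := {x | x.den.Coprime p}
  mul_mem' {x y} hx hy :=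
    Nat.Coprime.coprime_dvd_left (Rat.mul_den_dvd x y) (Nat.Coprime.mul_left hx hy)
  one_mem' := by simp
  add_mem' {x y} hx hy :=
    Nat.Coprime.coprime_dvd_left (Rat.add_den_dvd x y) (Nat.Coprime.mul_left hx hy)
  zero_mem' := by simp
  neg_mem' {x} hx := by simpa using hx

theorem mem_pIntegral {p : ℕ} {x : ℚ} : x ∈ pIntegral p ↔ x.den.Coprime p := Iff.rfl

theorem inv_natCast_mem_pIntegral {p j : ℕ} (hp : p.Prime) (hj : ¬ p ∣ j) :
    (j : ℚ)⁻¹ ∈ pIntegral p := by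
  rw [mem_pIntegral]
  have h0 : j ≠ 0 := by
    rintro rfl
    exact hj (dvd_zero p)
  rw [Rat.inv_natCast_den_of_pos (Nat.pos_of_ne_zero h0)]
  exact ((Nat.Prime.coprime_iff_not_dvd hp).2 hj).symm

theorem inv_natCast_mem_of_lt {p j : ℕ} (hp : p.Prime) (h0 : 0 < j) (hj : j < p) :
    (j : ℚ)⁻¹ ∈ pIntegral p :=
  inv_natCast_mem_pIntegral hp (Nat.not_dvd_of_pos_of_lt h0 hj)

/-- Congruence of rational numbers modulo `p ^ m` in the ring `pIntegral p`. -/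
def PCongr (p m : ℕ) (x y : ℚ) : Prop := ∃ t ∈ pIntegral p, x - y = (p : ℚ) ^ m * t

namespace PCongr

variable {p m : ℕ} {x y z x' y' c : ℚ}

theorem refl (p m : ℕ) (x : ℚ) : PCongr p m x x := ⟨0, zero_mem _, by ring⟩

theorem of_eq (h : x = y) : PCongr p m x y := h ▸ refl p m x

theorem symm (h : PCongr p m x y) : PCongr p m y x := by
  obtain ⟨t, ht, e⟩ := h
  exact ⟨-t, neg_mem ht, by linear_combination -e⟩

theorem trans (h : PCongr p m x y) (h' : PCongr p m y z) : PCongr p m x z := by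
  obtain ⟨t, ht, e⟩ := h
  obtain ⟨s, hs, e'⟩ := h'
  exact ⟨t + s, add_mem ht hs, by linear_combination e + e'⟩

theorem add (h : PCongr p m x y) (h' : PCongr p m x' y') : PCongr p m (x + x') (y + y') := by
  obtain ⟨t, ht, e⟩ := h
  obtain ⟨s, hs, e'⟩ := h'
  exact ⟨t + s, add_mem ht hs, by linear_combination e + e'⟩

theorem mul_left (hc : c ∈ pIntegral p) (h : PCongr p m x y) : PCongr p m (c * x) (c * y) := by
  obtain ⟨t, ht, e⟩ := h
  exact ⟨c * t, mul_mem hc ht, by linear_combination c * e⟩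

theorem sum {s : Finset ℕ} {f g : ℕ → ℚ} (h : ∀ k ∈ s, PCongr p m (f k) (g k)) :
    PCongr p m (∑ k ∈ s, f k) (∑ k ∈ s, g k) := by
  classical
  induction s using Finset.induction_on with
  | empty => exact refl _ _ _
  | insert a s ha ih =>
    rw [sum_insert ha, sum_insert ha]
    exact (h a (mem_insert_self a s)).add (ih fun k hk => h k (mem_insert_of_mem hk))

theorem of_le {l : ℕ} (hl : l ≤ m) (h : PCongr p m x y) : PCongr p l x y := by
  obtain ⟨t, ht, e⟩ := h
  refine ⟨(p : ℚ) ^ (m - l) * t, mul_mem (pow_mem (natCast_mem _ p) _) ht, ?_⟩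
  rw [e, ← mul_assoc, ← pow_add, Nat.add_sub_cancel' hl]

theorem of_prime_mul (hp : p ≠ 0) (h : PCongr p (m + 1) (p * x) (p * y)) : PCongr p m x y := by
  obtain ⟨t, ht, e⟩ := h
  have h1 : (p : ℚ) ≠ 0 := by exact_mod_cast hp
  refine ⟨t, ht, mul_left_cancel₀ h1 ?_⟩
  rw [mul_sub, e]
  ring

theorem mem_of_mem (h : PCongr p m x y) (hy : y ∈ pIntegral p) : x ∈ pIntegral p := by
  obtain ⟨t, ht, e⟩ := h
  rw [sub_eq_iff_eq_add.mp e]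
  exact add_mem (mul_mem (pow_mem (natCast_mem _ p) _) ht) hy

theorem ratCongr (h : PCongr p m x y) (hy : y ∈ pIntegral p) :
    RatCongr (p ^ m) x y := by
  have hx := h.mem_of_mem hy
  obtain ⟨t, ht, e⟩ := h
  refine ⟨Nat.Coprime.pow_right m hx, Nat.Coprime.pow_right m hy, t,
    Nat.Coprime.pow_right m ht, ?_⟩
  rw [e]
  push_cast
  rfl

end PCongr

theorem pow_sub_one_pCongr_one {p j : ℕ} (hp : p.Prime) (hj : ¬ p ∣ j) :
    PCongr p 1 ((j : ℚ) ^ (p - 1)) 1 := by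
  have h := (Nat.modEq_iff_dvd.mp (Nat.ModEq.symm
    (by simpa [Nat.totient_prime hp] using
      Nat.ModEq.pow_totient ((Nat.Prime.coprime_iff_not_dvd hp).2 hj).symm)))
  obtain ⟨t, ht⟩ := h
  refine ⟨t, intCast_mem _ t, ?_⟩
  push_cast at ht
  rw [pow_one]
  exact_mod_cast ht

/-! ### Rearrangements of sums over `0 < j ≤ 2n`. -/

theorem sum_range_two_mul_pair (n : ℕ) (f : ℕ → ℚ) :
    ∑ k ∈ range (2 * n), f (k + 1) =
      ∑ k ∈ range n, f (k + 1) + ∑ k ∈ range n, f (2 * n + 1 - (k + 1)) := by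
  rw [two_mul, sum_range_add, add_right_inj, ← sum_range_reflect]
  refine sum_congr rfl fun k hk => ?_
  congr 1
  have := mem_range.mp hk
  omega

/-- As `2n + 1` is odd, the odd indices are exactly its differences with the even ones. -/
theorem sum_range_two_mul_even_odd (n : ℕ) (f : ℕ → ℚ) :
    ∑ k ∈ range (2 * n), f (k + 1) =
      ∑ k ∈ range n, f (2 * (k + 1)) + ∑ k ∈ range n, f (2 * n + 1 - 2 * (k + 1)) := by
  have h : ∑ k ∈ range n, f (2 * n + 1 - 2 * (k + 1)) = ∑ k ∈ range n, f (2 * k + 1) := by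
    rw [← sum_range_reflect]
    refine sum_congr rfl fun k hk => ?_
    congr 1
    have := mem_range.mp hk
    omega
  rw [h]
  clear h
  induction n with
  | zero => simp
  | succ n ih =>
    rw [show 2 * (n + 1) = 2 * n + 1 + 1 by ring, sum_range_succ, sum_range_succ, ih,
      sum_range_succ, sum_range_succ]
    ring_nf

theorem sum_range_two_mul_alternating (n : ℕ) (f : ℕ → ℚ) :
    ∑ k ∈ range (2 * n), (-1) ^ (k + 1) * f (k + 1) =
      2 * ∑ k ∈ range n, f (2 * (k + 1)) - ∑ k ∈ range (2 * n), f (k + 1) := by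
  induction n with
  | zero => simp
  | succ n ih =>
    rw [show 2 * (n + 1) = 2 * n + 1 + 1 by ring, sum_range_succ, sum_range_succ, ih,
      sum_range_succ, sum_range_succ, sum_range_succ]
    have h1 : (-1 : ℚ) ^ (2 * n + 1) = -1 := by rw [pow_succ, pow_mul]; norm_num
    have h2 : (-1 : ℚ) ^ (2 * n + 1 + 1) = 1 := by rw [pow_succ, h1]; norm_num
    rw [h1, h2]
    ring_nf

theorem sum_range_two_mul_alternating_pair (n : ℕ) (f : ℕ → ℚ) :
    ∑ k ∈ range (2 * n), (-1) ^ (k + 1) * f (k + 1) =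
      ∑ k ∈ range n, (-1) ^ (k + 1) * (f (k + 1) - f (2 * n + 1 - (k + 1))) := by
  rw [sum_range_two_mul_pair n (fun j => (-1) ^ j * f j), ← sum_add_distrib]
  refine sum_congr rfl fun k hk => ?_
  have := mem_range.mp hk
  have h : (-1 : ℚ) ^ (2 * n + 1 - (k + 1)) = -(-1) ^ (k + 1) := by
    rcases Nat.even_or_odd (k + 1) with h | h
    · rw [h.neg_one_pow, Odd.neg_one_pow]
      exact Nat.Odd.sub_even (by omega) ⟨n, rfl⟩ h
    · rw [h.neg_one_pow, Even.neg_one_pow, neg_neg]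
      exact Nat.Odd.sub_odd ⟨n, rfl⟩ h
  rw [h]
  ring

/-! ### Harmonic sums up to `(p-1)/2` modulo powers of `p`. -/

/-- The generalized harmonic number `∑_{0 < j ≤ n} 1 / j ^ m`. -/
def harmonicPow (n m : ℕ) : ℚ := ∑ k ∈ range n, ((k + 1 : ℕ) : ℚ)⁻¹ ^ m

/-- The alternating harmonic number `∑_{0 < j ≤ n} (-1) ^ j / j ^ m`. -/
def altHarmonicPow (n m : ℕ) : ℚ := ∑ k ∈ range n, (-1) ^ (k + 1) * ((k + 1 : ℕ) : ℚ)⁻¹ ^ m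

theorem harmonicPow_one (n : ℕ) : harmonicPow n 1 = harmonic n := by
  simp [harmonicPow, harmonic]

section

variable {p n : ℕ}

theorem inv_succ_mem (hp : p.Prime) (hn : n < p) {k : ℕ} (hk : k ∈ range n) :
    ((k + 1 : ℕ) : ℚ)⁻¹ ∈ pIntegral p :=
  inv_natCast_mem_of_lt hp (Nat.succ_pos k) (by have := mem_range.mp hk; omega)

theorem harmonicPow_mem (hp : p.Prime) (hn : n < p) (m : ℕ) :
    harmonicPow n m ∈ pIntegral p :=
  sum_mem fun _ hk => pow_mem (inv_succ_mem hp hn hk) _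

theorem harmonic_mem (hp : p.Prime) (hn : n < p) : harmonic n ∈ pIntegral p :=
  harmonicPow_one n ▸ harmonicPow_mem hp hn 1

/-- Substituted into itself, this exact identity expands `1/(p-j)` to any order in `p`. -/
theorem inv_sub_eq {j : ℕ} (h0 : 0 < j) (hj : j < p) :
    ((p - j : ℕ) : ℚ)⁻¹ = p * (j : ℚ)⁻¹ * ((p - j : ℕ) : ℚ)⁻¹ - (j : ℚ)⁻¹ := by
  have h1 : (j : ℚ) ≠ 0 := by exact_mod_cast h0.ne'
  have h2 : ((p - j : ℕ) : ℚ) ≠ 0 := by exact_mod_cast (by omega : p - j ≠ 0)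
  field_simp
  push_cast [hj.le]
  ring

theorem inv_sub_pCongr (hp : p.Prime) {j : ℕ} (h0 : 0 < j) (hj : j < p) :
    PCongr p 3 ((p - j : ℕ) : ℚ)⁻¹
      (-((j : ℚ)⁻¹ + p * (j : ℚ)⁻¹ ^ 2 + p ^ 2 * (j : ℚ)⁻¹ ^ 3)) := by
  have hu := inv_natCast_mem_of_lt hp h0 hj
  have hv := inv_natCast_mem_of_lt hp (show 0 < p - j by omega) (show p - j < p by omega)
  have h := inv_sub_eq h0 hj
  set u := (j : ℚ)⁻¹
  set v := ((p - j : ℕ) : ℚ)⁻¹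
  exact ⟨u ^ 3 * v, mul_mem (pow_mem hu 3) hv,
    by linear_combination (1 + p * u + p ^ 2 * u ^ 2) * h⟩

theorem inv_sub_sq_pCongr (hp : p.Prime) {j : ℕ} (h0 : 0 < j) (hj : j < p) :
    PCongr p 2 (((p - j : ℕ) : ℚ)⁻¹ ^ 2) ((j : ℚ)⁻¹ ^ 2 + p * (2 * (j : ℚ)⁻¹ ^ 3)) := by
  have hu := inv_natCast_mem_of_lt hp h0 hj
  obtain ⟨t, ht, h⟩ := (inv_sub_pCongr hp h0 hj).of_le (show 2 ≤ 3 by omega)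
  set u := (j : ℚ)⁻¹
  set v := ((p - j : ℕ) : ℚ)⁻¹
  have hv : v = -(u + p * u ^ 2 + p ^ 2 * u ^ 3) + p ^ 2 * t := by linear_combination h
  have hP := natCast_mem (pIntegral p) p
  have h2 := ofNat_mem (pIntegral p) 2
  refine ⟨(u ^ 2 + p * u ^ 3 - p * t) ^ 2 + 2 * u * (u ^ 3 - t), ?_, ?_⟩
  · apply_rules [add_mem, sub_mem, mul_mem, pow_mem]
  · rw [hv]
    ring

theorem inv_sub_cube_pCongr (hp : p.Prime) {j : ℕ} (h0 : 0 < j) (hj : j < p) :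
    PCongr p 1 (((p - j : ℕ) : ℚ)⁻¹ ^ 3) (-(j : ℚ)⁻¹ ^ 3) := by
  have hu := inv_natCast_mem_of_lt hp h0 hj
  have hv := inv_natCast_mem_of_lt hp (show 0 < p - j by omega) (show p - j < p by omega)
  have h := inv_sub_eq h0 hj
  set u := (j : ℚ)⁻¹
  set v := ((p - j : ℕ) : ℚ)⁻¹
  refine ⟨u * v * (v ^ 2 - u * v + u ^ 2), ?_, ?_⟩
  · apply_rules [add_mem, sub_mem, mul_mem, pow_mem]
  · linear_combination (v ^ 2 - u * v + u ^ 2) * h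

/-- Comparison of the two decompositions of `∑_{0 < j < p} f j` for a function `f` which is even
up to a multiple of `p` and multiplicative at `2`. -/
theorem half_sum_pCongr (hpn : p = 2 * n + 1) {f g : ℕ → ℚ} {a b : ℚ}
    (h : ∀ j, 0 < j → j < p → PCongr p 2 (f (p - j)) (f j + p * g j))
    (hf : ∀ j, f (2 * j) = a * f j) (hg : ∀ j, g (2 * j) = b * g j) :
    PCongr p 2 (∑ k ∈ range (2 * n), f (k + 1))
        (2 * ∑ k ∈ range n, f (k + 1) + p * ∑ k ∈ range n, g (k + 1)) ∧
      PCongr p 2 (∑ k ∈ range (2 * n), f (k + 1))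
        (2 * a * ∑ k ∈ range n, f (k + 1) + p * b * ∑ k ∈ range n, g (k + 1)) := by
  constructor
  · rw [sum_range_two_mul_pair, ← hpn]
    have : PCongr p 2 (∑ k ∈ range n, f (p - (k + 1)))
        (∑ k ∈ range n, (f (k + 1) + p * g (k + 1))) :=
      PCongr.sum fun k hk => h _ (by omega) (by have := mem_range.mp hk; omega)
    rw [sum_add_distrib, ← mul_sum] at this
    convert (PCongr.refl p 2 (∑ k ∈ range n, f (k + 1))).add this using 1
    ring
  · rw [sum_range_two_mul_even_odd, ← hpn]
    have : PCongr p 2 (∑ k ∈ range n, f (p - 2 * (k + 1)))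
        (∑ k ∈ range n, (f (2 * (k + 1)) + p * g (2 * (k + 1)))) :=
      PCongr.sum fun k hk => h _ (by omega) (by have := mem_range.mp hk; omega)
    rw [sum_add_distrib, ← mul_sum] at this
    simp only [hf, hg, ← mul_sum] at this ⊢
    convert (PCongr.refl p 2 (a * ∑ k ∈ range n, f (k + 1))).add this using 1
    ring

/-- Equating the two evaluations of the sum of `1/j²` over `0 < j < p` leaves `(3/2) S_2 ≡ -(7/4) p
S_3`. -/
theorem harmonicPow_two_pCongr (hp : p.Prime) (hpn : p = 2 * n + 1) :
    PCongr p 2 (6 * harmonicPow n 2) (-7 * p * harmonicPow n 3) := by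
  have h := half_sum_pCongr hpn (f := fun j => (j : ℚ)⁻¹ ^ 2) (g := fun j => 2 * (j : ℚ)⁻¹ ^ 3)
    (a := 1 / 4) (b := 1 / 8) (fun j h0 hj => inv_sub_sq_pCongr hp h0 hj)
    (fun j => by push_cast; rw [mul_inv]; ring) (fun j => by push_cast; rw [mul_inv]; ring)
  obtain ⟨t, ht, e⟩ := h.1.symm.trans h.2
  rw [← mul_sum] at e
  have h4 := ofNat_mem (pIntegral p) 4
  refine ⟨4 * t, mul_mem h4 ht, ?_⟩
  simp only [harmonicPow]
  linear_combination 4 * e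

/-- Pairing `j` with `p - j` cancels the leading terms and leaves `-p S_2 - p² S_3`; a refinement of
Wolstenholme's theorem. -/
theorem harmonic_two_mul_pCongr (hp : p.Prime) (hpn : p = 2 * n + 1) :
    PCongr p 3 (6 * harmonic (2 * n)) (p ^ 2 * harmonicPow n 3) := by
  have h1 : PCongr p 3 (∑ k ∈ range n, ((p - (k + 1) : ℕ) : ℚ)⁻¹)
      (∑ k ∈ range n, -(((k + 1 : ℕ) : ℚ)⁻¹ + p * ((k + 1 : ℕ) : ℚ)⁻¹ ^ 2
        + p ^ 2 * ((k + 1 : ℕ) : ℚ)⁻¹ ^ 3)) :=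
    PCongr.sum fun k hk => inv_sub_pCongr hp (by omega) (by have := mem_range.mp hk; omega)
  have h2 := sum_range_two_mul_pair n (fun j => (j : ℚ)⁻¹)
  obtain ⟨t, ht, e⟩ := h1
  obtain ⟨s, hs, e'⟩ := harmonicPow_two_pCongr hp hpn
  rw [sum_neg_distrib, sum_add_distrib, sum_add_distrib, ← mul_sum, ← mul_sum] at e
  have h6 := ofNat_mem (pIntegral p) 6
  rw [← hpn] at h2
  refine ⟨6 * t - s, sub_mem (mul_mem h6 ht) hs, ?_⟩
  simp only [harmonicPow] at e' ⊢
  rw [harmonic]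
  linear_combination 6 * h2 + 6 * e - p * e'

/-- Both sides evaluate the sum of `(-1)^j / j` over `0 < j < p`: by doubling the even terms, and by
pairing `j` with `p - j`, which has opposite parity. -/
theorem harmonic_sub_pCongr (hp : p.Prime) (hpn : p = 2 * n + 1) :
    PCongr p 3 (harmonic n - harmonic (2 * n))
      (2 * altHarmonicPow n 1 + p * altHarmonicPow n 2 + p ^ 2 * altHarmonicPow n 3) := by
  have h1 := (sum_range_two_mul_alternating_pair n (fun j => (j : ℚ)⁻¹)).symm.trans
    (sum_range_two_mul_alternating n (fun j => (j : ℚ)⁻¹))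
  rw [← hpn] at h1
  have h2 : 2 * ∑ k ∈ range n, ((2 * (k + 1) : ℕ) : ℚ)⁻¹ = harmonic n := by
    rw [harmonic, mul_sum]
    refine sum_congr rfl fun k _ => ?_
    push_cast
    rw [mul_inv]
    ring
  rw [h2] at h1
  rw [harmonic.eq_1 (2 * n), ← h1]
  simp only [altHarmonicPow, mul_sum, ← sum_add_distrib]
  refine PCongr.sum fun k hk => ?_
  obtain ⟨t, ht, e⟩ := inv_sub_pCongr hp (j := k + 1) (by omega)
    (by have := mem_range.mp hk; omega)
  refine ⟨-(-1) ^ (k + 1) * t, mul_mem (neg_mem (pow_mem (neg_mem (one_mem _)) _)) ht, ?_⟩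
  linear_combination -(-1) ^ (k + 1) * e

theorem altHarmonicPow_three_pCongr (hp : p.Prime) (hpn : p = 2 * n + 1) :
    PCongr p 1 (8 * altHarmonicPow n 3) (harmonicPow n 3) := by
  have h0 := sum_range_two_mul_pair n (fun j => (j : ℚ)⁻¹ ^ 3)
  have h1 := (sum_range_two_mul_alternating_pair n (fun j => (j : ℚ)⁻¹ ^ 3)).symm.trans
    (sum_range_two_mul_alternating n (fun j => (j : ℚ)⁻¹ ^ 3))
  rw [h0, ← hpn] at h1
  have e1 : PCongr p 1 (∑ k ∈ range n, ((p - (k + 1) : ℕ) : ℚ)⁻¹ ^ 3)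
      (∑ k ∈ range n, -((k + 1 : ℕ) : ℚ)⁻¹ ^ 3) :=
    PCongr.sum fun k hk => inv_sub_cube_pCongr hp (by omega) (by have := mem_range.mp hk; omega)
  have e2 : PCongr p 1
      (∑ k ∈ range n, (-1) ^ (k + 1) * (((k + 1 : ℕ) : ℚ)⁻¹ ^ 3 - ((p - (k + 1) : ℕ) : ℚ)⁻¹ ^ 3))
      (2 * altHarmonicPow n 3) := by
    rw [altHarmonicPow, mul_sum]
    refine PCongr.sum fun k hk => ?_
    obtain ⟨t, ht, e⟩ := inv_sub_cube_pCongr hp (j := k + 1) (by omega)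
      (by have := mem_range.mp hk; omega)
    refine ⟨-(-1) ^ (k + 1) * t, mul_mem (neg_mem (pow_mem (neg_mem (one_mem _)) _)) ht, ?_⟩
    linear_combination -(-1) ^ (k + 1) * e
  have e3 : ∑ k ∈ range n, ((2 * (k + 1) : ℕ) : ℚ)⁻¹ ^ 3 = harmonicPow n 3 / 8 := by
    rw [harmonicPow, sum_div]
    refine sum_congr rfl fun k _ => ?_
    push_cast
    rw [mul_inv]
    ring
  rw [sum_neg_distrib] at e1
  rw [h1, e3] at e2
  obtain ⟨t, ht, e1⟩ := e1
  obtain ⟨s, hs, e2⟩ := e2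
  have h4 := ofNat_mem (pIntegral p) 4
  refine ⟨-4 * (s + t), mul_mem (neg_mem h4) (add_mem hs ht), ?_⟩
  linear_combination -4 * e2 - 4 * e1

/-- Eliminates `H_{2n}` and `A_3`; the coefficient is `-7 = -4 - 3`. -/
theorem two_mul_altHarmonicPow_one_pCongr (hp : p.Prime) (hpn : p = 2 * n + 1) :
    PCongr p 3 (24 * (2 * altHarmonicPow n 1 - harmonic n + p * altHarmonicPow n 2))
      (-7 * p ^ 2 * harmonicPow n 3) := by
  obtain ⟨t, ht, e⟩ := harmonic_two_mul_pCongr hp hpn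
  obtain ⟨s, hs, e'⟩ := harmonic_sub_pCongr hp hpn
  obtain ⟨r, hr, e''⟩ := altHarmonicPow_three_pCongr hp hpn
  have h4 := ofNat_mem (pIntegral p) 4
  have h24 := ofNat_mem (pIntegral p) 24
  have h3' := ofNat_mem (pIntegral p) 3
  refine ⟨-24 * s - 4 * t - 3 * r, ?_, ?_⟩
  · exact sub_mem (sub_mem (mul_mem (neg_mem h24) hs) (mul_mem h4 ht)) (mul_mem h3' hr)
  · linear_combination -24 * e' - 4 * e - 3 * p ^ 2 * e''

end

/-! ### Bernoulli numbers and the sum of inverse cubes. -/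

theorem bernoulli_mem_pIntegral {p : ℕ} (hp : p.Prime) (i : ℕ) (hi : i + 1 < p) :
    bernoulli i ∈ pIntegral p := by
  induction i using Nat.strong_induction_on with
  | _ i ih =>
    have h := sum_bernoulli (i + 1)
    rw [sum_range_succ] at h
    have hs : ∑ k ∈ range i, ((i + 1).choose k : ℚ) * bernoulli k ∈ pIntegral p :=
      sum_mem fun k hk => mul_mem (natCast_mem _ _)
        (ih k (mem_range.mp hk) (by have := mem_range.mp hk; omega))
    have hc : (if i + 1 = 1 then 1 else 0 : ℚ) ∈ pIntegral p := by
      split_ifs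
      exacts [one_mem _, zero_mem _]
    rw [← h, add_comm] at hc
    have h1 := sub_mem hc hs
    rw [add_sub_cancel_right, Nat.choose_succ_self_right] at h1
    -- The recursion divides only by `i + 1`, which is smaller than `p`.
    have h2 := mul_mem (inv_natCast_mem_of_lt hp (Nat.succ_pos i) hi) h1
    rwa [inv_mul_cancel_left₀ (by positivity)] at h2

/-- In Faulhaber's formula all terms but the one linear in `p` carry `p²`. -/
theorem sum_pow_pCongr_bernoulli {p r : ℕ} (hp : p.Prime) (hr : p = 2 * r + 5) :
    PCongr p 2 (∑ k ∈ range (2 * (r + 2)), ((k + 1 : ℕ) : ℚ) ^ (2 * r + 2))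
      (p * bernoulli (p - 3)) := by
  have h := sum_range_pow p (2 * r + 2)
  rw [sum_range_succ] at h
  have h1 : ∑ k ∈ range p, (k : ℚ) ^ (2 * r + 2) =
      ∑ k ∈ range (2 * (r + 2)), ((k + 1 : ℕ) : ℚ) ^ (2 * r + 2) := by
    rw [hr, show 2 * r + 5 = 2 * (r + 2) + 1 by ring, sum_range_succ']
    simp
  have h2 : bernoulli (2 * r + 2) * ((2 * r + 2 + 1).choose (2 * r + 2) : ℚ) *
      (p : ℚ) ^ (2 * r + 2 + 1 - (2 * r + 2)) / (((2 * r + 2 : ℕ) : ℚ) + 1) =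
        p * bernoulli (p - 3) := by
    rw [show p - 3 = 2 * r + 2 by omega, Nat.choose_succ_self_right, Nat.add_sub_cancel_left,
      pow_one]
    push_cast
    field_simp
  rw [h1, h2] at h
  rw [h]
  have h3 : PCongr p 2 (∑ i ∈ range (2 * r + 2), bernoulli i * ((2 * r + 2 + 1).choose i : ℚ) *
      (p : ℚ) ^ (2 * r + 2 + 1 - i) / (((2 * r + 2 : ℕ) : ℚ) + 1)) (∑ i ∈ range (2 * r + 2), 0) := by
    refine PCongr.sum fun i hi => ?_
    have hi' := mem_range.mp hi
    refine ⟨bernoulli i * ((2 * r + 2 + 1).choose i : ℚ) * (p : ℚ) ^ (2 * r + 1 - i) *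
      ((2 * r + 2 + 1 : ℕ) : ℚ)⁻¹, ?_, ?_⟩
    · exact mul_mem (mul_mem (mul_mem (bernoulli_mem_pIntegral hp i (by omega))
        (natCast_mem _ _)) (pow_mem (natCast_mem _ _) _))
        (inv_natCast_mem_of_lt hp (by omega) (by omega))
    · rw [show 2 * r + 2 + 1 - i = 2 * r + 1 - i + 2 by omega, pow_add, div_eq_mul_inv]
      push_cast
      ring
  rw [sum_const_zero] at h3
  simpa using h3.add (PCongr.refl p 2 (p * bernoulli (p - 3)))

theorem sub_pow_pCongr {p r j : ℕ} (hr : p = 2 * r + 5) (hj : j < p) :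
    PCongr p 2 (((p - j : ℕ) : ℚ) ^ (2 * r + 2))
      ((j : ℚ) ^ (2 * r + 2) + p * (3 * (j : ℚ) ^ (2 * r + 1))) := by
  obtain ⟨t, ht⟩ := Polynomial.powAddExpansion (-(j : ℤ)) (p : ℤ) (2 * r + 2)
  refine ⟨t - (j : ℚ) ^ (2 * r + 1), sub_mem (intCast_mem _ t) (pow_mem (natCast_mem _ _) _), ?_⟩
  have e1 : (-(j : ℤ)) ^ (2 * r + 2) = (j : ℤ) ^ (2 * r + 2) :=
    Even.neg_pow ⟨r + 1, by ring⟩ _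
  have e2 : (-(j : ℤ)) ^ (2 * r + 2 - 1) = -(j : ℤ) ^ (2 * r + 1) :=
    Odd.neg_pow ⟨r, by omega⟩ _
  rw [e1, e2] at ht
  have ht' : (-(j : ℚ) + p) ^ (2 * r + 2) = (j : ℚ) ^ (2 * r + 2)
    + ((2 * r + 2 : ℕ) : ℚ) * (-(j : ℚ) ^ (2 * r + 1)) * p + t * p ^ 2 := by exact_mod_cast ht
  have hp' : (p : ℚ) = 2 * r + 5 := by exact_mod_cast hr
  rw [Nat.cast_sub hj.le, show (p : ℚ) - j = -j + p by ring, ht']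
  push_cast
  linear_combination (p * (j : ℚ) ^ (2 * r + 1)) * hp'

/-- By Fermat `S_3 ≡ T`, the sum of `j^(p-4)`. With `S` the sum of `j^(p-3)`, the half-sum
comparison gives `12 S ≡ -21 p T` mod `p²`, while Faulhaber gives `p B_{p-3} ≡ 2S + 3pT ≡ -p T / 2`.
-/
theorem harmonicPow_three_pCongr {p n : ℕ} (hp : p.Prime) (h3 : 3 < p) (hpn : p = 2 * n + 1) :
    PCongr p 1 (harmonicPow n 3) (-2 * bernoulli (p - 3)) := by
  obtain ⟨r, rfl⟩ : ∃ r, n = r + 2 := ⟨n - 2, by omega⟩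
  have hr : p = 2 * r + 5 := by omega
  have hP := natCast_mem (pIntegral p) p
  have hp0 : (p : ℚ) ≠ 0 := by exact_mod_cast hp.ne_zero
  have h := half_sum_pCongr hpn (f := fun j => (j : ℚ) ^ (2 * r + 2))
    (g := fun j => 3 * (j : ℚ) ^ (2 * r + 1))
    (a := 2 ^ (2 * r + 2)) (b := 2 ^ (2 * r + 1)) (fun j _ hj => sub_pow_pCongr hr hj)
    (fun j => by push_cast; rw [mul_pow]) (fun j => by push_cast; rw [mul_pow]; ring)
  have hT : PCongr p 1 (harmonicPow (r + 2) 3)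
      (∑ k ∈ range (r + 2), ((k + 1 : ℕ) : ℚ) ^ (2 * r + 1)) := by
    refine PCongr.sum fun k hk => ?_
    have hk' := mem_range.mp hk
    have hu := inv_natCast_mem_of_lt hp (show 0 < k + 1 by omega) (by omega)
    have h0 : ((k + 1 : ℕ) : ℚ) ≠ 0 := by exact_mod_cast (Nat.succ_ne_zero k)
    have := (pow_sub_one_pCongr_one hp
      (Nat.not_dvd_of_pos_of_lt (show 0 < k + 1 by omega) (by omega))).mul_left (pow_mem hu 3)
    rw [mul_one, show p - 1 = 2 * r + 1 + 3 by omega, pow_add] at this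
    convert this.symm using 1
    field_simp
  have hTm : ∑ k ∈ range (r + 2), ((k + 1 : ℕ) : ℚ) ^ (2 * r + 1) ∈ pIntegral p :=
    sum_mem fun k _ => pow_mem (natCast_mem _ _) _
  have hSm : ∑ k ∈ range (r + 2), ((k + 1 : ℕ) : ℚ) ^ (2 * r + 2) ∈ pIntegral p :=
    sum_mem fun k _ => pow_mem (natCast_mem _ _) _
  have hB := sum_pow_pCongr_bernoulli hp hr
  obtain ⟨q, hq, eq⟩ := pow_sub_one_pCongr_one hp
    (Nat.not_dvd_of_pos_of_lt (show 0 < 2 by omega) (show 2 < p by omega))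
  rw [show p - 1 = 2 * r + 2 + 2 by omega, pow_one] at eq
  push_cast at eq
  rw [pow_add] at eq
  obtain ⟨t, ht, et⟩ := h.1.symm.trans h.2
  obtain ⟨s, hs, es⟩ := h.1.symm.trans hB
  simp only [← mul_sum, pow_succ _ (2 * r + 1)] at et es eq
  simp only [← pow_succ] at et es
  obtain ⟨v, hv, ev⟩ := hT
  set T := ∑ k ∈ range (r + 2), ((k + 1 : ℕ) : ℚ) ^ (2 * r + 1)
  set S := ∑ k ∈ range (r + 2), ((k + 1 : ℕ) : ℚ) ^ (2 * r + 2)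
  have h12 : ((12 : ℕ) : ℚ)⁻¹ ∈ pIntegral p := by
    refine inv_natCast_mem_pIntegral hp fun hd => ?_
    rw [show 12 = 2 * 2 * 3 by norm_num, hp.dvd_mul, hp.dvd_mul] at hd
    rcases hd with (hd | hd) | hd <;> have := Nat.le_of_dvd (by norm_num) hd <;> omega
  have m4 := ofNat_mem (pIntegral p) 4
  have m3 := ofNat_mem (pIntegral p) 3
  have m6 := ofNat_mem (pIntegral p) 6
  have m8 := ofNat_mem (pIntegral p) 8
  have m21 := ofNat_mem (pIntegral p) 21
  -- This shows `p ∣ S`, so the cross term `4 p q S` is negligible modulo `p²`.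
  have hS : 12 * S = p * (4 * q * S - 21 * T + 3 * p * q * T + 8 * p * t) := by
    linear_combination 8 * et + (4 * S + 3 * p * T) * eq
  have hW : 4 * q * S - 21 * T + 3 * p * q * T + 8 * p * t ∈ pIntegral p := by
    apply_rules [add_mem, sub_mem, mul_mem]
  set W := 4 * q * S - 21 * T + 3 * p * q * T + 8 * p * t with hWdef
  refine ⟨v + 4 * ((12 : ℕ) : ℚ)⁻¹ *
    (4 * q * (W * ((12 : ℕ) : ℚ)⁻¹) + 3 * q * T + 8 * t - 6 * s), ?_, ?_⟩
  · apply_rules [add_mem, sub_mem, mul_mem]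
  · apply mul_left_cancel₀ hp0
    push_cast
    linear_combination p * ev - 2 * es + (1 / 9 * p * q + 1 / 3) * hS + p / 3 * hWdef

/-! ### Central binomial coefficient, Fermat quotient and Morley's congruence. -/

theorem two_mul_prod_one_sub_pCongr {p : ℕ} (n : ℕ) {x : ℕ → ℚ}
    (hx : ∀ k ∈ range n, x k ∈ pIntegral p) :
    PCongr p 3 (2 * ∏ k ∈ range n, (1 - p * x k))
      (2 - 2 * p * ∑ k ∈ range n, x k
        + p ^ 2 * ((∑ k ∈ range n, x k) ^ 2 - ∑ k ∈ range n, x k ^ 2)) := by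
  have hP := natCast_mem (pIntegral p) p
  have h1 := one_mem (pIntegral p)
  induction n with
  | zero => exact PCongr.of_eq (by simp)
  | succ n ih =>
    have hx' : ∀ k ∈ range n, x k ∈ pIntegral p := fun k hk =>
      hx k (mem_range.mpr (by have := mem_range.mp hk; omega))
    have hxn := hx n (self_mem_range_succ n)
    obtain ⟨t, ht, e⟩ := ih hx'
    have he : ∑ k ∈ range n, x k ∈ pIntegral p := sum_mem hx'
    have hs : ∑ k ∈ range n, x k ^ 2 ∈ pIntegral p := sum_mem fun k hk => pow_mem (hx' k hk) 2
    rw [prod_range_succ, sum_range_succ, sum_range_succ]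
    set u := ∑ k ∈ range n, x k
    set s := ∑ k ∈ range n, x k ^ 2
    refine ⟨t * (1 - p * x n) - x n * (u ^ 2 - s), ?_, ?_⟩
    · exact sub_mem (mul_mem ht (sub_mem h1 (mul_mem hP hxn)))
        (mul_mem hxn (sub_mem (pow_mem he 2) hs))
    · linear_combination (1 - p * x n) * e

theorem prod_one_sub_div_succ (N m : ℕ) :
    ∏ k ∈ range m, (1 - ((N : ℚ) + 1) * ((k + 1 : ℕ) : ℚ)⁻¹) = (-1) ^ m * N.choose m := by
  induction m with
  | zero => simp
  | succ m ih =>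
    have h := succ_mul_choose_succ_eq N m
    have h0 : (m : ℚ) + 1 ≠ 0 := by positivity
    rw [prod_range_succ, ih]
    apply mul_left_cancel₀ h0
    push_cast
    rw [pow_succ]
    field_simp
    linear_combination h

/-- A second product for the same binomial coefficient, with `p/2` in place of `p`: the numerators
`2n + 1 - 2j` run over the odd numbers below `2n`. -/
theorem pow_mul_prod_one_sub_div_two (n : ℕ) :
    2 ^ (2 * n) * ∏ k ∈ range n, (1 - (2 * (n : ℚ) + 1) * (((k + 1 : ℕ) : ℚ)⁻¹ / 2)) =
      (-1) ^ n * (2 * n).choose n := by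
  have h1 : ∀ m : ℕ, (∏ k ∈ range m, (2 * (k : ℚ) + 1)) * 2 ^ m =
      (∏ k ∈ range m, ((k : ℚ) + 1)) * (2 * m).choose m := by
    intro m
    induction m with
    | zero => simp
    | succ m ih =>
      have h := Nat.succ_mul_centralBinom_succ m
      rw [Nat.centralBinom_eq_two_mul_choose, Nat.centralBinom_eq_two_mul_choose] at h
      have h' : ((m : ℚ) + 1) * (2 * (m + 1)).choose (m + 1) =
          2 * (2 * m + 1) * (2 * m).choose m := by exact_mod_cast h
      rw [prod_range_succ, prod_range_succ, pow_succ]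
      linear_combination 2 * (2 * (m : ℚ) + 1) * ih - (∏ k ∈ range m, ((k : ℚ) + 1)) * h'
  have h2 : (∏ k ∈ range n, (1 - (2 * (n : ℚ) + 1) * (((k + 1 : ℕ) : ℚ)⁻¹ / 2))) *
      ∏ k ∈ range n, (2 * ((k : ℚ) + 1)) = ∏ k ∈ range n, (-1 * (2 * (k : ℚ) + 1)) := by
    rw [← prod_mul_distrib, ← prod_range_reflect (fun k : ℕ => -1 * (2 * (k : ℚ) + 1))]
    refine prod_congr rfl fun k hk => ?_
    have hk' := mem_range.mp hk
    have h0 : (k : ℚ) + 1 ≠ 0 := by positivity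
    rw [show n - 1 - k = n - (k + 1) by omega, Nat.cast_sub (by omega)]
    push_cast
    field_simp
    ring
  have h3 : ∏ k ∈ range n, ((k : ℚ) + 1) ≠ 0 := prod_ne_zero_iff.mpr fun k _ => by positivity
  rw [prod_mul_distrib, prod_mul_distrib, prod_const, prod_const, card_range] at h2
  have h4 : ((2 : ℚ) ^ n) ≠ 0 := by positivity
  apply mul_right_cancel₀ h3
  rw [show (2 : ℚ) ^ (2 * n) = 2 ^ n * 2 ^ n by rw [two_mul, pow_add]]
  linear_combination 2 ^ n * h2 + (-1) ^ n * h1 n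

theorem prime_not_dvd_four {p : ℕ} (h3 : 3 < p) (hp : p.Prime) : ¬ p ∣ 4 := fun h => by
  rw [show 4 = 2 * 2 by rfl, hp.dvd_mul] at h
  rcases h with h | h <;> have := Nat.le_of_dvd (by norm_num) h <;> omega

theorem prime_not_dvd_twelve {p : ℕ} (h3 : 3 < p) (hp : p.Prime) : ¬ p ∣ 12 := fun h => by
  rw [show 12 = 4 * 3 by rfl, hp.dvd_mul] at h
  rcases h with h | h
  · exact prime_not_dvd_four h3 hp h
  · have := Nat.le_of_dvd (by norm_num) h
    omega

theorem fermatQuotient_two_spec {p : ℕ} (hp : p ≠ 0) :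
    (2 : ℚ) ^ (p - 1) = 1 + p * fermatQuotient p 2 := by
  have hp0 : (p : ℚ) ≠ 0 := by exact_mod_cast hp
  rw [fermatQuotient]
  push_cast
  field_simp
  ring

theorem fermatQuotient_two_mem {p : ℕ} (hp : p.Prime) (h2 : 2 < p) :
    fermatQuotient p 2 ∈ pIntegral p := by
  have hp0 : (p : ℚ) ≠ 0 := by exact_mod_cast hp.ne_zero
  obtain ⟨t, ht, e⟩ := pow_sub_one_pCongr_one hp (Nat.not_dvd_of_pos_of_lt two_pos h2)
  push_cast at e
  rw [fermatQuotient_two_spec hp.ne_zero, pow_one, add_sub_cancel_left] at e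
  rwa [mul_left_cancel₀ hp0 e]

section

variable {p n : ℕ}

theorem harmonicPow_two_eq_mul (hp : p.Prime) (h3 : 3 < p) (hpn : p = 2 * n + 1) :
    ∃ t ∈ pIntegral p, harmonicPow n 2 = p * t := by
  have h12 := inv_natCast_mem_pIntegral hp (prime_not_dvd_twelve h3 hp)
  obtain ⟨t, ht, e⟩ := harmonicPow_two_pCongr hp hpn
  have hT := harmonicPow_mem hp (show n < p by omega) 3
  have m2 := ofNat_mem (pIntegral p) 2
  have m7 := ofNat_mem (pIntegral p) 7
  have hP := natCast_mem (pIntegral p) p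
  refine ⟨2 * ((12 : ℕ) : ℚ)⁻¹ * (p * t - 7 * harmonicPow n 3), ?_, ?_⟩
  · apply_rules [sub_mem, mul_mem]
  · push_cast
    linear_combination e / 6

/-- The product of the `1 - p/j` to second order; its quadratic coefficient `(H_n² - S_2)/2` loses
`S_2`, a multiple of `p`. -/
theorem central_pCongr (hp : p.Prime) (h3 : 3 < p) (hpn : p = 2 * n + 1) :
    PCongr p 3 (2 * ((-1) ^ n * (2 * n).choose n))
      (2 - 2 * p * harmonic n + p ^ 2 * harmonic n ^ 2) := by
  obtain ⟨s, hs, es⟩ := harmonicPow_two_eq_mul hp h3 hpn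
  have h := two_mul_prod_one_sub_pCongr (p := p) n (x := fun k => ((k + 1 : ℕ) : ℚ)⁻¹)
    (fun k hk => inv_succ_mem hp (by omega) hk)
  obtain ⟨t, ht, e⟩ := h
  have hq : (p : ℚ) = (2 * n : ℕ) + 1 := by exact_mod_cast hpn
  have h2 := prod_one_sub_div_succ (2 * n) n
  rw [← hq] at h2
  rw [h2] at e
  change _ - (2 - 2 * p * harmonic n + p ^ 2 * (harmonic n ^ 2 - harmonicPow n 2)) = _ at e
  refine ⟨t - s, sub_mem ht hs, ?_⟩
  linear_combination e - p ^ 2 * es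

theorem central_pCongr_pow_mul (hp : p.Prime) (h3 : 3 < p) (hpn : p = 2 * n + 1) :
    PCongr p 3 (8 * ((-1) ^ n * (2 * n).choose n))
      (2 ^ (p - 1) * (8 - 4 * p * harmonic n + p ^ 2 * harmonic n ^ 2)) := by
  obtain ⟨s, hs, es⟩ := harmonicPow_two_eq_mul hp h3 hpn
  have hi2 := inv_natCast_mem_of_lt hp two_pos (by omega)
  have h := two_mul_prod_one_sub_pCongr (p := p) n (x := fun k => ((k + 1 : ℕ) : ℚ)⁻¹ / 2)
    (fun k hk => mul_mem (inv_succ_mem hp (by omega) hk) hi2)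
  obtain ⟨t, ht, e⟩ := h
  have hq : (p : ℚ) = 2 * n + 1 := by exact_mod_cast hpn
  have h2 := pow_mul_prod_one_sub_div_two n
  rw [← hq] at h2
  have e1 : ∑ k ∈ range n, ((k + 1 : ℕ) : ℚ)⁻¹ / 2 = harmonic n / 2 := by
    rw [harmonic, sum_div]
  have e2 : ∑ k ∈ range n, (((k + 1 : ℕ) : ℚ)⁻¹ / 2) ^ 2 = harmonicPow n 2 / 4 := by
    rw [harmonicPow, sum_div]
    exact sum_congr rfl fun k _ => by ring
  rw [e1, e2] at e
  have m4 := ofNat_mem (pIntegral p) 4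
  have m2 := ofNat_mem (pIntegral p) 2
  rw [show p - 1 = 2 * n by omega]
  refine ⟨2 ^ (2 * n) * (4 * t - s), mul_mem (pow_mem m2 _) (sub_mem (mul_mem m4 ht) hs), ?_⟩
  linear_combination 4 * 2 ^ (2 * n) * e - 2 ^ (2 * n) * p ^ 2 * es - 8 * h2

/-- The two expansions of `(-1)^n C(2n,n)` differ by the factor `2^(p-1) = 1 + pq`; comparing them
determines `H_n`. -/
theorem harmonic_pCongr_fermatQuotient (hp : p.Prime) (h3 : 3 < p) (hpn : p = 2 * n + 1) :
    PCongr p 2 (harmonic n) (-2 * fermatQuotient p 2 + p * fermatQuotient p 2 ^ 2) := by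
  have hp0 : (p : ℚ) ≠ 0 := by exact_mod_cast hp.ne_zero
  have hP := natCast_mem (pIntegral p) p
  have hi4 := inv_natCast_mem_pIntegral hp (prime_not_dvd_four h3 hp)
  have hq := fermatQuotient_two_mem hp (by omega)
  have hH := harmonic_mem hp (show n < p by omega)
  have hQ := fermatQuotient_two_spec hp.ne_zero
  have m2 := ofNat_mem (pIntegral p) 2
  have m3 := ofNat_mem (pIntegral p) 3
  have m4 := ofNat_mem (pIntegral p) 4
  obtain ⟨s, hs, es⟩ := central_pCongr_pow_mul hp h3 hpn
  obtain ⟨t, ht, et⟩ := central_pCongr hp h3 hpn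
  rw [hQ] at es
  set q := fermatQuotient p 2
  set h := harmonic n
  have key : 4 * h + 8 * q = p * (4 * q * h + 3 * h ^ 2 + p * (4 * t - s - q * h ^ 2)) := by
    apply mul_left_cancel₀ hp0
    linear_combination 4 * et - es
  set Y := 4 * t - s - q * h ^ 2 with hYdef
  have hY : Y ∈ pIntegral p := by
    apply_rules [sub_mem, mul_mem, pow_mem]
  -- First approximation `h = -2q + p w`, fed back into `key` for the next order.
  set w := ((4 : ℕ) : ℚ)⁻¹ * (4 * q * h + 3 * h ^ 2 + p * Y) with hwdef
  have hw : w ∈ pIntegral p := by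
    clear_value Y w
    rw [hwdef]
    apply_rules [add_mem, mul_mem, pow_mem]
  have hhw : h = -2 * q + p * w := by
    rw [hwdef]
    push_cast
    linear_combination key / 4
  refine ⟨((4 : ℕ) : ℚ)⁻¹ * (3 * p * w ^ 2 - 4 * 2 * q * w + Y), ?_, ?_⟩
  · clear_value Y w
    apply_rules [add_mem, sub_mem, mul_mem, pow_mem]
  · push_cast
    linear_combination key / 4 + (p * (4 * q + 3 * (h - 2 * q + p * w)) / 4) * hhw

theorem central_pCongr_fermatQuotient (hp : p.Prime) (h3 : 3 < p) (hpn : p = 2 * n + 1) :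
    PCongr p 3 ((-1) ^ n * (2 * n).choose n) ((1 + p * fermatQuotient p 2) ^ 2) := by
  have hP := natCast_mem (pIntegral p) p
  have hi2 := inv_natCast_mem_of_lt hp two_pos (by omega)
  have hq := fermatQuotient_two_mem hp (by omega)
  have hH := harmonic_mem hp (show n < p by omega)
  have m2 := ofNat_mem (pIntegral p) 2
  obtain ⟨t, ht, et⟩ := central_pCongr hp h3 hpn
  obtain ⟨s, hs, es⟩ := harmonic_pCongr_fermatQuotient hp h3 hpn
  set q := fermatQuotient p 2
  set h := harmonic n
  refine ⟨((2 : ℕ) : ℚ)⁻¹ * (t - 2 * s + (h - 2 * q) * (q ^ 2 + p * s)), ?_, ?_⟩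
  · apply_rules [add_mem, sub_mem, mul_mem, pow_mem]
  · push_cast
    linear_combination et / 2 + (p ^ 2 * (h - 2 * q) / 2 - p) * es

end

/-! ### Euler numbers as alternating power sums. -/

theorem eulerNumber_of_odd {n : ℕ} (hn : Odd n) : eulerNumber n = 0 := by
  induction n using Nat.strong_induction_on with
  | _ n ih =>
    rw [eulerNumber_eq n hn.pos, neg_eq_zero]
    refine sum_eq_zero fun k hk => ?_
    have hk' := mem_Icc.mp hk
    obtain ⟨m, rfl⟩ := hn
    rw [ih _ (by omega) ⟨m - k, by omega⟩, mul_zero]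

theorem sum_range_mul_one_add_neg_one_pow (g : ℕ → ℚ) (n : ℕ) :
    ∑ k ∈ range (n + 1), g k * (1 + (-1) ^ k) = 2 * ∑ k ∈ range (n / 2 + 1), g (2 * k) := by
  induction n with
  | zero => simp; ring
  | succ n ih =>
    rw [sum_range_succ, ih]
    rcases Nat.even_or_odd' n with ⟨m, rfl | rfl⟩
    · rw [show (2 * m + 1) / 2 = 2 * m / 2 by omega, pow_succ, pow_mul]
      norm_num
    · rw [show (2 * m + 1 + 1) / 2 = (2 * m + 1) / 2 + 1 by omega,
        sum_range_succ _ ((2 * m + 1) / 2 + 1), show (2 * m + 1) / 2 + 1 = m + 1 by omega,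
        show 2 * m + 1 + 1 = 2 * (m + 1) by ring, pow_mul]
      norm_num
      ring

theorem sum_choose_mul_eulerNumber {n : ℕ} (hn : 1 ≤ n) :
    ∑ k ∈ range (n / 2 + 1), (n.choose (2 * k) : ℚ) * eulerNumber (n - 2 * k) = 0 := by
  have h := eulerNumber_eq n hn
  have h' : (eulerNumber n : ℚ) =
      -∑ k ∈ Icc 1 (n / 2), (n.choose (2 * k) : ℚ) * eulerNumber (n - 2 * k) := by exact_mod_cast h
  rw [sum_range_succ', range_eq_Ico, sum_Ico_add'
    (fun k => (n.choose (2 * k) : ℚ) * eulerNumber (n - 2 * k)), mul_zero, Nat.sub_zero, h',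
    Nat.choose_zero_right, Nat.cast_one, one_mul, zero_add, ← sub_eq_add_neg, sub_eq_zero]
  rfl

/-- The polynomial `∑ k, (n choose k) * E k * X ^ (n - k)`, a rescaling of the Euler polynomial. -/
noncomputable def eulerPoly (n : ℕ) : Polynomial ℚ :=
  ∑ k ∈ range (n + 1), Polynomial.monomial (n - k) ((n.choose k : ℚ) * eulerNumber k)

theorem derivative_eulerPoly (n : ℕ) :
    Polynomial.derivative (eulerPoly (n + 1)) = (n + 1 : Polynomial ℚ) * eulerPoly n := by
  have hc : (n + 1 : Polynomial ℚ) = Polynomial.C ((n : ℚ) + 1) := by simp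
  rw [eulerPoly, sum_range_succ, Polynomial.derivative_add, Polynomial.derivative_sum, eulerPoly,
    mul_sum]
  simp only [Polynomial.derivative_monomial, Nat.sub_self, Nat.cast_zero, mul_zero,
    Polynomial.monomial_zero_right, add_zero, hc, Polynomial.C_mul_monomial]
  refine sum_congr rfl fun k hk => ?_
  have hk' := mem_range.mp hk
  rw [show n + 1 - k - 1 = n - k by omega]
  congr 1
  have h := Nat.choose_mul_succ_eq n k
  have h' : (n.choose k : ℚ) * (n + 1) = (n + 1).choose k * ((n + 1 - k : ℕ) : ℚ) := by
    exact_mod_cast h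
  linear_combination -(eulerNumber k : ℚ) * h'

theorem eulerPoly_eval (n : ℕ) (x : ℚ) :
    (eulerPoly n).eval x = ∑ k ∈ range (n + 1), (n.choose k : ℚ) * eulerNumber k * x ^ (n - k) := by
  simp [eulerPoly, Polynomial.eval_finsetSum]

theorem eulerPoly_eval_one_add_eval_neg_one {n : ℕ} (hn : 1 ≤ n) :
    (eulerPoly n).eval 1 + (eulerPoly n).eval (-1) = 0 := by
  have h := sum_range_mul_one_add_neg_one_pow
    (fun k => (n.choose k : ℚ) * eulerNumber (n - k)) n
  rw [sum_choose_mul_eulerNumber hn, mul_zero, ← sum_range_reflect] at h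
  rw [eulerPoly_eval, eulerPoly_eval, ← sum_add_distrib, ← h]
  refine sum_congr rfl fun k hk => ?_
  have hk' := mem_range.mp hk
  rw [show n + 1 - 1 - k = n - k by omega, Nat.choose_symm (by omega),
    show n - (n - k) = k by omega]
  ring

/-- The polynomials form an Appell sequence, so differentiation gives the induction step up to a
constant; the defining recurrence makes that constant zero. -/
theorem eulerPoly_comp_add_comp (n : ℕ) :
    (eulerPoly n).comp (Polynomial.X + 1) + (eulerPoly n).comp (Polynomial.X - 1) =
      2 * Polynomial.X ^ n := by
  induction n with
  | zero =>
    simp [eulerPoly, eulerNumber_zero]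
    norm_num
  | succ n ih =>
    rw [← sub_eq_zero]
    have hd : Polynomial.derivative ((eulerPoly (n + 1)).comp (Polynomial.X + 1) +
        (eulerPoly (n + 1)).comp (Polynomial.X - 1) - 2 * Polynomial.X ^ (n + 1)) = 0 := by
      simp only [Polynomial.derivative_sub, Polynomial.derivative_add, Polynomial.derivative_comp,
        derivative_eulerPoly, Polynomial.derivative_mul, Polynomial.derivative_X_pow]
      simp
      linear_combination (n + 1 : Polynomial ℚ) * ih
    have hC := Polynomial.eq_C_of_derivative_eq_zero hd
    rw [hC, Polynomial.C_eq_zero, Polynomial.coeff_zero_eq_eval_zero]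
    have := eulerPoly_eval_one_add_eval_neg_one (show 1 ≤ n + 1 by omega)
    simpa using this

theorem eulerPoly_eval_add (n : ℕ) (x : ℚ) :
    (eulerPoly n).eval (x + 1) + (eulerPoly n).eval (x - 1) = 2 * x ^ n := by
  have := congrArg (Polynomial.eval x) (eulerPoly_comp_add_comp n)
  simpa using this

theorem eulerPoly_eval_one {n : ℕ} (hn : Even n) (h0 : 1 ≤ n) : (eulerPoly n).eval 1 = 0 := by
  have h := eulerPoly_eval_one_add_eval_neg_one h0
  have h1 : (eulerPoly n).eval (-1) = (eulerPoly n).eval 1 := by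
    rw [eulerPoly_eval, eulerPoly_eval]
    refine sum_congr rfl fun k hk => ?_
    rcases Nat.even_or_odd k with hk | hk
    · rw [(hn.tsub hk).neg_one_pow, one_pow]
    · rw [eulerNumber_of_odd hk]
      simp
  linarith

theorem eulerPoly_eval_odd {n : ℕ} (hn : Even n) (h0 : 1 ≤ n) (m : ℕ) :
    (eulerPoly n).eval (2 * (m : ℚ) + 1) =
      (-1) ^ m * ∑ k ∈ range m, (-1) ^ (k + 1) * (2 * (2 * ((k + 1 : ℕ) : ℚ)) ^ n) := by
  induction m with
  | zero => simp [eulerPoly_eval_one hn h0]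
  | succ m ih =>
    have h := eulerPoly_eval_add n (2 * ((m + 1 : ℕ) : ℚ))
    rw [show 2 * ((m + 1 : ℕ) : ℚ) - 1 = 2 * (m : ℚ) + 1 by push_cast; ring, ih] at h
    have h1 : (-1 : ℚ) ^ m * (-1) ^ m = 1 := by rw [← mul_pow]; norm_num
    rw [sum_range_succ, pow_succ (-1 : ℚ) m]
    linear_combination h - 2 * (2 * ((m + 1 : ℕ) : ℚ)) ^ n * h1

/-- Only even `k` contribute, so every term with `k < n` has `n - k ≥ 2`. -/
theorem eulerPoly_eval_pCongr (p : ℕ) {n : ℕ} (hn : Even n) :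
    PCongr p 2 ((eulerPoly n).eval (p : ℚ)) (eulerNumber n) := by
  rw [eulerPoly_eval, sum_range_succ]
  have h : PCongr p 2 (∑ k ∈ range n, (n.choose k : ℚ) * eulerNumber k * (p : ℚ) ^ (n - k))
      (∑ k ∈ range n, 0) := by
    refine PCongr.sum fun k hk => ?_
    have hk' := mem_range.mp hk
    rcases Nat.even_or_odd k with hk | hk
    · have h2 : 2 ≤ n - k := by
        have := hn.tsub hk
        obtain ⟨m, hm⟩ := this
        omega
      refine ⟨(n.choose k : ℚ) * eulerNumber k * (p : ℚ) ^ (n - k - 2),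
        mul_mem (mul_mem (natCast_mem _ _) (intCast_mem _ _)) (pow_mem (natCast_mem _ _) _), ?_⟩
      rw [show n - k = n - k - 2 + 2 by omega, pow_add, Nat.add_sub_cancel]
      ring
    · rw [eulerNumber_of_odd hk]
      exact PCongr.of_eq (by simp)
  rw [sum_const_zero] at h
  simpa using h.add (PCongr.refl p 2 (eulerNumber n : ℚ))

theorem eulerNumber_pCongr_sum {p m n : ℕ} (hp : p = 2 * m + 1) (hn : Even n) (h0 : 1 ≤ n) :
    PCongr p 2 (eulerNumber n)
      ((-1) ^ m * ∑ k ∈ range m, (-1) ^ (k + 1) * (2 * ((2 * (k + 1) : ℕ) : ℚ) ^ n)) := by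
  have h := eulerPoly_eval_pCongr p hn
  have hq : (p : ℚ) = 2 * m + 1 := by exact_mod_cast hp
  rw [hq, eulerPoly_eval_odd hn h0 m] at h
  push_cast at h ⊢
  exact h.symm

theorem eulerNumber_pCongr_altHarmonicPow {p n : ℕ} (hp : p.Prime) (h3 : 3 < p)
    (hpn : p = 2 * n + 1) :
    PCongr p 1 (2 * (eulerNumber (p - 3) : ℚ)) ((-1) ^ n * altHarmonicPow n 2) := by
  have m2 := ofNat_mem (pIntegral p) 2
  have m1 : (-1 : ℚ) ∈ pIntegral p := neg_mem (one_mem _)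
  have he : Even (p - 3) := ⟨n - 1, by omega⟩
  refine (((eulerNumber_pCongr_sum hpn he (by omega)).of_le (by omega)).mul_left m2).trans ?_
  rw [mul_left_comm]
  refine PCongr.mul_left (pow_mem m1 n) ?_
  rw [altHarmonicPow, mul_sum]
  refine PCongr.sum fun k hk => ?_
  have hk' := mem_range.mp hk
  obtain ⟨t, ht, e⟩ := pow_sub_one_pCongr_one hp
    (Nat.not_dvd_of_pos_of_lt (show 0 < 2 * (k + 1) by omega) (by omega))
  have hu := inv_succ_mem hp (show n < p by omega) hk
  have h0 : ((k + 1 : ℕ) : ℚ) ≠ 0 := by exact_mod_cast (Nat.succ_ne_zero k)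
  refine ⟨(-1) ^ (k + 1) * ((k + 1 : ℕ) : ℚ)⁻¹ ^ 2 * t,
    mul_mem (mul_mem (pow_mem m1 _) (pow_mem hu 2)) ht, ?_⟩
  have e1 : ((2 * (k + 1) : ℕ) : ℚ) ^ (p - 1) * ((k + 1 : ℕ) : ℚ)⁻¹ ^ 2 =
      4 * ((2 * (k + 1) : ℕ) : ℚ) ^ (p - 3) := by
    rw [show p - 1 = p - 3 + 2 by omega, pow_add]
    push_cast at h0 ⊢
    field_simp
    ring
  linear_combination (-1) ^ (k + 1) * (((k + 1 : ℕ) : ℚ)⁻¹ ^ 2 * e - e1)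

/-- With `x = (2j)^(p-1) ≡ 1` mod `p`, the combination contributes `(x² - 2x)/(2j)² = ((x-1)² -
1)/(2j)²`, which is `-1/(2j)²` mod `p²`. -/
theorem eulerNumber_sub_pCongr_altHarmonicPow {p n : ℕ} (hp : p.Prime) (h3 : 3 < p)
    (hpn : p = 2 * n + 1) :
    PCongr p 2 (2 * ((eulerNumber (2 * p - 4) : ℚ) - 2 * eulerNumber (p - 3)))
      (-((-1) ^ n * altHarmonicPow n 2)) := by
  have m2 := ofNat_mem (pIntegral p) 2
  have m1 : (-1 : ℚ) ∈ pIntegral p := neg_mem (one_mem _)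
  have h1 := eulerNumber_pCongr_sum hpn (n := p - 3) ⟨n - 1, by omega⟩ (by omega)
  have h2 := eulerNumber_pCongr_sum hpn (n := 2 * p - 4) ⟨2 * n - 1, by omega⟩ (by omega)
  have h4 := (h2.add (h1.mul_left (neg_mem m2))).mul_left m2
  rw [show (eulerNumber (2 * p - 4) : ℚ) - 2 * eulerNumber (p - 3) =
    eulerNumber (2 * p - 4) + -2 * eulerNumber (p - 3) by ring]
  refine h4.trans ?_
  rw [mul_left_comm (-2 : ℚ), ← mul_add, mul_left_comm, ← mul_neg]
  refine PCongr.mul_left (pow_mem m1 n) ?_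
  rw [altHarmonicPow, mul_sum, ← sum_add_distrib, mul_sum, ← sum_neg_distrib]
  refine PCongr.sum fun k hk => ?_
  have hk' := mem_range.mp hk
  obtain ⟨t, ht, e⟩ := pow_sub_one_pCongr_one hp
    (Nat.not_dvd_of_pos_of_lt (show 0 < 2 * (k + 1) by omega) (by omega))
  have hu := inv_succ_mem hp (show n < p by omega) hk
  have h0 : ((k + 1 : ℕ) : ℚ) ≠ 0 := by exact_mod_cast (Nat.succ_ne_zero k)
  refine ⟨(-1) ^ (k + 1) * ((k + 1 : ℕ) : ℚ)⁻¹ ^ 2 * t ^ 2,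
    mul_mem (mul_mem (pow_mem m1 _) (pow_mem hu 2)) (pow_mem ht 2), ?_⟩
  have e1 : ((2 * (k + 1) : ℕ) : ℚ) ^ (p - 1) * ((k + 1 : ℕ) : ℚ)⁻¹ ^ 2 =
      4 * ((2 * (k + 1) : ℕ) : ℚ) ^ (p - 3) := by
    rw [show p - 1 = p - 3 + 2 by omega, pow_add]
    push_cast at h0 ⊢
    field_simp
    ring
  have e2 : ((2 * (k + 1) : ℕ) : ℚ) ^ (2 * p - 4) =
      ((2 * (k + 1) : ℕ) : ℚ) ^ (p - 1) * ((2 * (k + 1) : ℕ) : ℚ) ^ (p - 3) := by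
    rw [← pow_add]
    congr 1
    omega
  rw [e2]
  set x := ((2 * (k + 1) : ℕ) : ℚ) ^ (p - 1)
  linear_combination (-1) ^ (k + 1) * (((k + 1 : ℕ) : ℚ)⁻¹ ^ 2 * (x - 1 + p * t) * e - (x - 2) * e1)

/-! ### Reduction of the sums to the closed forms, and conclusion. -/

section

variable {p n : ℕ}

theorem shiftedLegendreCoeff_mem (p n k : ℕ) : shiftedLegendreCoeff n k ∈ pIntegral p :=
  mul_mem (mul_mem (pow_mem (neg_mem (one_mem _)) _) (natCast_mem _ _)) (natCast_mem _ _)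

/-- The ratios of consecutive terms are `(2k+1)² / (4(k+1)²)` and `((2k+1)² - p²) / (4(k+1)²)`,
since `4(n-k)(n+k+1) = p² - (2k+1)²`. -/
theorem choose_sq_div_pow_pCongr (hp : p.Prime) (hpn : p = 2 * n + 1) (k : ℕ) (hk : k ≤ n) :
    PCongr p 2 (((2 * k).choose k : ℚ) ^ 2 / 16 ^ k) (shiftedLegendreCoeff n k) := by
  induction k with
  | zero => exact PCongr.of_eq (by simp [shiftedLegendreCoeff])
  | succ k ih =>
    obtain ⟨t, ht, e⟩ := ih (by omega)
    have hw := inv_natCast_mem_of_lt hp (show 0 < 2 * (k + 1) by omega) (by omega)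
    have ha := shiftedLegendreCoeff_mem p n k
    have hr := shiftedLegendreCoeff_succ n k
    have hq : (p : ℚ) = 2 * n + 1 := by exact_mod_cast hpn
    have h0 : (k : ℚ) + 1 ≠ 0 := by positivity
    have h16 : (16 : ℚ) ^ k ≠ 0 := by positivity
    have hc : ((k : ℚ) + 1) * (2 * (k + 1)).choose (k + 1) =
        2 * (2 * k + 1) * (2 * k).choose k := by
      have h := Nat.succ_mul_centralBinom_succ k
      rw [Nat.centralBinom_eq_two_mul_choose, Nat.centralBinom_eq_two_mul_choose] at h
      exact_mod_cast h
    have hc' : ((k : ℚ) + 1) ^ 2 * (((2 * (k + 1)).choose (k + 1) : ℚ) ^ 2 / 16 ^ (k + 1)) =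
        (2 * k + 1) ^ 2 / 4 * (((2 * k).choose k : ℚ) ^ 2 / 16 ^ k) := by
      rw [pow_succ 16 k]
      field_simp
      linear_combination 4 * ((k + 1) * ((2 * (k + 1)).choose (k + 1) : ℚ) +
        2 * (2 * k + 1) * (2 * k).choose k) * hc
    refine ⟨((2 * (k + 1) : ℕ) : ℚ)⁻¹ ^ 2 *
      (((2 * k + 1 : ℕ) : ℚ) ^ 2 * t + shiftedLegendreCoeff n k), mul_mem (pow_mem hw 2)
        (add_mem (mul_mem (pow_mem (natCast_mem _ _) 2) ht) ha), ?_⟩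
    apply mul_left_cancel₀ (pow_ne_zero 2 h0)
    rw [mul_sub, hc', hr]
    have e1 : ((2 * (k + 1) : ℕ) : ℚ)⁻¹ ^ 2 * ((k : ℚ) + 1) ^ 2 = 1 / 4 := by
      push_cast
      field_simp
      norm_num
    push_cast at e1 ⊢
    linear_combination (2 * (k : ℚ) + 1) ^ 2 / 4 * e
      - p ^ 2 * ((2 * (k : ℚ) + 1) ^ 2 * t + shiftedLegendreCoeff n k) * e1
      - shiftedLegendreCoeff n k / 4 * (p + (2 * n + 1)) * hq

theorem sum_choose_sq_pCongr (hp : p.Prime) (hpn : p = 2 * n + 1) {f : ℕ → ℚ}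
    (hf : ∀ k < n, f k ∈ pIntegral p) :
    PCongr p 2 (∑ k ∈ range n, ((2 * k).choose k : ℚ) ^ 2 * f k / ((2 * k + 1) * 16 ^ k))
      (∑ k ∈ range n, shiftedLegendreCoeff n k * f k / (2 * k + 1)) := by
  refine PCongr.sum fun k hk => ?_
  have hk' := mem_range.mp hk
  have hi := inv_natCast_mem_of_lt hp (show 0 < 2 * k + 1 by omega) (by omega)
  have h := (choose_sq_div_pow_pCongr hp hpn k hk'.le).mul_left (mul_mem hi (hf k hk'))
  convert h using 1 <;> push_cast <;> field_simp

theorem prime_mul_sum_shiftedLegendreCoeff (hpn : p = 2 * n + 1) (f : ℕ → ℚ) :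
    p * ∑ k ∈ range n, shiftedLegendreCoeff n k * f k / (2 * k + 1) =
      (2 * (n : ℚ) + 1) * ∑ k ∈ range (n + 1), shiftedLegendreCoeff n k * f k / (2 * k + 1) -
        (-1) ^ n * (2 * n).choose n * f n := by
  have hq : (p : ℚ) = 2 * n + 1 := by exact_mod_cast hpn
  have h0 : 2 * (n : ℚ) + 1 ≠ 0 := by positivity
  have hc : shiftedLegendreCoeff n n = (-1) ^ n * (2 * n).choose n := by
    simp [shiftedLegendreCoeff, two_mul]
  rw [sum_range_succ, hc, hq]
  field_simp
  ring

theorem altHarmonicPow_one (n : ℕ) :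
    altHarmonicPow n 1 = ∑ k ∈ range n, (-1) ^ (k + 1) / ((k : ℚ) + 1) := by
  simp [altHarmonicPow, div_eq_mul_inv]

theorem two_mul_altHarmonicPow_one_sub_harmonic_pCongr (hp : p.Prime) (h3 : 3 < p)
    (hpn : p = 2 * n + 1) :
    PCongr p 3 (2 * altHarmonicPow n 1 - harmonic n)
      (-p * altHarmonicPow n 2 + 7 / 12 * p ^ 2 * bernoulli (p - 3)) := by
  obtain ⟨t, ht, et⟩ := two_mul_altHarmonicPow_one_pCongr hp hpn
  obtain ⟨s, hs, es⟩ := harmonicPow_three_pCongr hp h3 hpn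
  have hi := inv_natCast_mem_pIntegral hp (prime_not_dvd_twelve h3 hp)
  have hi2 := inv_natCast_mem_of_lt hp two_pos (by omega)
  have m7 := ofNat_mem (pIntegral p) 7
  refine ⟨((12 : ℕ) : ℚ)⁻¹ * ((2 : ℕ) : ℚ)⁻¹ * (t - 7 * s),
    mul_mem (mul_mem hi hi2) (sub_mem ht (mul_mem m7 hs)), ?_⟩
  push_cast
  linear_combination et / 24 - 7 / 24 * p ^ 2 * es

/-- After multiplication by `p` the difference is `(2 A_1 - H_n) + H_n (1 - (1 + pq)²)`; the last
product is `4 p q²` mod `p³`, the `q³` terms cancelling. -/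
theorem sum_choose_sq_mul_harmonic_pCongr (hp : p.Prime) (h3 : 3 < p) (hpn : p = 2 * n + 1) :
    PCongr p 2 (∑ k ∈ range n, ((2 * k).choose k : ℚ) ^ 2 * harmonic k / ((2 * k + 1) * 16 ^ k))
      (4 * fermatQuotient p 2 ^ 2 - altHarmonicPow n 2 + 7 / 12 * p * bernoulli (p - 3)) := by
  refine (sum_choose_sq_pCongr hp hpn fun k hk => harmonic_mem hp (by omega)).trans ?_
  refine PCongr.of_prime_mul hp.ne_zero ?_
  rw [prime_mul_sum_shiftedLegendreCoeff hpn, sum_shiftedLegendreCoeff_mul_harmonic,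
    ← altHarmonicPow_one]
  obtain ⟨t, ht, et⟩ := two_mul_altHarmonicPow_one_sub_harmonic_pCongr hp h3 hpn
  obtain ⟨s, hs, es⟩ := central_pCongr_fermatQuotient hp h3 hpn
  obtain ⟨r, hr, er⟩ := harmonic_pCongr_fermatQuotient hp h3 hpn
  have hH := harmonic_mem hp (show n < p by omega)
  have hP := natCast_mem (pIntegral p) p
  have hq := fermatQuotient_two_mem hp (by omega)
  have m2 := ofNat_mem (pIntegral p) 2
  set q := fermatQuotient p 2
  set h := harmonic n
  refine ⟨t - s * h - (2 * q + p * q ^ 2) * r - q ^ 4, ?_, ?_⟩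
  · apply_rules [add_mem, sub_mem, mul_mem, pow_mem]
  · linear_combination et - h * es - p * (2 * q + p * q ^ 2) * er

/-- The removed term contains `H_{2n}`, a multiple of `p²`, so only `2 A_1 - H_n ≡ -p A_2` survives
mod `p²`. -/
theorem sum_choose_sq_mul_harmonic_two_mul_pCongr (hp : p.Prime) (h3 : 3 < p)
    (hpn : p = 2 * n + 1) :
    PCongr p 1
      (∑ k ∈ range n, ((2 * k).choose k : ℚ) ^ 2 * harmonic (2 * k) / ((2 * k + 1) * 16 ^ k))
      (-altHarmonicPow n 2) := by
  refine ((sum_choose_sq_pCongr hp hpn (f := fun k => harmonic (2 * k))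
    fun k hk => harmonic_mem hp (by omega)).of_le one_le_two).trans ?_
  refine PCongr.of_prime_mul hp.ne_zero ?_
  rw [prime_mul_sum_shiftedLegendreCoeff hpn (fun k => harmonic (2 * k)),
    sum_shiftedLegendreCoeff_mul_harmonic_two_mul, ← altHarmonicPow_one]
  obtain ⟨t, ht, et⟩ := two_mul_altHarmonicPow_one_sub_harmonic_pCongr hp h3 hpn
  obtain ⟨s, hs, es⟩ := harmonic_two_mul_pCongr hp hpn
  have hi := inv_natCast_mem_pIntegral hp (prime_not_dvd_twelve h3 hp)
  have hB := bernoulli_mem_pIntegral hp (p - 3) (by omega)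
  have hT := harmonicPow_mem hp (show n < p by omega) 3
  have hP := natCast_mem (pIntegral p) p
  have m2 := ofNat_mem (pIntegral p) 2
  have m7 := ofNat_mem (pIntegral p) 7
  have hC : (-1) ^ n * ((2 * n).choose n : ℚ) ∈ pIntegral p :=
    mul_mem (pow_mem (neg_mem (one_mem _)) _) (natCast_mem _ _)
  set C := (-1) ^ n * ((2 * n).choose n : ℚ)
  refine ⟨p * t + 7 * ((12 : ℕ) : ℚ)⁻¹ * bernoulli (p - 3) -
    2 * ((12 : ℕ) : ℚ)⁻¹ * C * (harmonicPow n 3 + p * s), ?_, ?_⟩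
  · apply_rules [add_mem, sub_mem, mul_mem, pow_mem]
  · push_cast
    linear_combination et - C / 6 * es

end

theorem legendreSym_neg_one_eq {p n : ℕ} [Fact p.Prime] (hpn : p = 2 * n + 1) (h2 : p ≠ 2) :
    (legendreSym p (-1) : ℚ) = (-1) ^ n := by
  rw [legendreSym.at_neg_one h2, ZMod.χ₄_eq_neg_one_pow (by omega),
    show p / 2 = n by omega]
  push_cast
  rfl

theorem theorem1p1 (p : ℕ) [Fact p.Prime] (hp : 3 < p) :
    RatCongr (p ^ 2)
      (∑ k ∈ Finset.range ((p - 3) / 2 + 1),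
        ((2 * k).choose k : ℚ) ^ 2 * harmonic k / ((2 * (k : ℚ) + 1) * 16 ^ k))
      (4 * fermatQuotient p 2 ^ 2
        + 2 * (legendreSym p (-1) : ℚ)
          * ((eulerNumber (2 * p - 4) : ℚ) - 2 * (eulerNumber (p - 3) : ℚ))
        + 7 / 12 * (p : ℚ) * bernoulli (p - 3)) ∧
    RatCongr p
      (∑ k ∈ Finset.range ((p - 3) / 2 + 1),
        ((2 * k).choose k : ℚ) ^ 2 * harmonic (2 * k) / ((2 * (k : ℚ) + 1) * 16 ^ k))
      (-2 * (legendreSym p (-1) : ℚ) * (eulerNumber (p - 3) : ℚ)) := by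
  have hP : p.Prime := Fact.out
  obtain ⟨n, hpn⟩ : ∃ n, p = 2 * n + 1 := (hP.odd_of_ne_two (by omega))
  rw [legendreSym_neg_one_eq hpn (by omega), show (p - 3) / 2 + 1 = n by omega]
  have m1 : (-1 : ℚ) ∈ pIntegral p := neg_mem (one_mem _)
  have m2 := ofNat_mem (pIntegral p) 2
  have m4 := ofNat_mem (pIntegral p) 4
  have m7 := ofNat_mem (pIntegral p) 7
  -- The Legendre symbol is its own inverse, which moves it across the Euler number congruences.
  have hs : (-1 : ℚ) ^ n * (-1) ^ n = 1 := by rw [← mul_pow]; norm_num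
  have hq := fermatQuotient_two_mem hP (by omega)
  have hB := bernoulli_mem_pIntegral hP (p - 3) (by omega)
  have hi := inv_natCast_mem_pIntegral hP (prime_not_dvd_twelve hp hP)
  have hE : (eulerNumber (p - 3) : ℚ) ∈ pIntegral p := intCast_mem _ _
  have hE' : (eulerNumber (2 * p - 4) : ℚ) ∈ pIntegral p := intCast_mem _ _
  constructor
  · refine PCongr.ratCongr ?_ ?_
    · refine (sum_choose_sq_mul_harmonic_pCongr hP hp hpn).trans ?_
      obtain ⟨t, ht, e⟩ :=
        (eulerNumber_sub_pCongr_altHarmonicPow hP hp hpn).mul_left (pow_mem m1 n)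
      exact ⟨-t, neg_mem ht, by linear_combination -e + altHarmonicPow n 2 * hs⟩
    · rw [show (7 / 12 : ℚ) = 7 * ((12 : ℕ) : ℚ)⁻¹ by norm_num]
      exact add_mem (add_mem (mul_mem m4 (pow_mem hq 2)) (mul_mem (mul_mem m2 (pow_mem m1 n))
        (sub_mem hE' (mul_mem m2 hE)))) (mul_mem (mul_mem (mul_mem m7 hi) (natCast_mem _ p)) hB)
  · have h : PCongr p 1 (∑ k ∈ Finset.range n,
        ((2 * k).choose k : ℚ) ^ 2 * harmonic (2 * k) / ((2 * (k : ℚ) + 1) * 16 ^ k))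
        (-2 * (-1) ^ n * (eulerNumber (p - 3) : ℚ)) := by
      refine (sum_choose_sq_mul_harmonic_two_mul_pCongr hP hp hpn).trans ?_
      obtain ⟨t, ht, e⟩ := (eulerNumber_pCongr_altHarmonicPow hP hp hpn).mul_left (pow_mem m1 n)
      exact ⟨t, ht, by linear_combination e + altHarmonicPow n 2 * hs⟩
    simpa using h.ratCongr (mul_mem (mul_mem (neg_mem m2) (pow_mem m1 n)) hE)
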